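/- Let $M$ be an infinite field with algebraic closure $\overline M$. For $\mathbf a=(s,t)\in M^2$ let $$f_{\mathbf a}(X)=X^5+(t-3)X^4+(s-t+3)X^3+(t^2-t-2s-1)X^2+sX+t$$ be Brumer's dihedral quintic, $L_{\mathbf a}\subset\overline M$ its splitting field over $M$ and $G_{\mathbf a}=\mathrm{Gal}(L_{\mathbf a}/M)$; for $\mathbf a,\mathbf a'\in M^2$ let $G_{\mathbf a,\mathbf a'}$ be the Galois group over $M$ of $f_{\mathbf a}f_{\mathbf a'}$. For nonzero $x,y$ put $(z_0,\dots,z_4)=\bigl(x,\,y,\,\tfrac{1-y}{x},\,\tfrac{x+y-1}{xy},\,\tfrac{1-x}{y}\bigr)$, indices being taken modulo $5$, and write $(x,y)\mapsto\mathbf a$ if $f_{\mathbf a}(X)=\prod_i(X-z_i)$. Let $\rho(x,y)=\bigl(\tfrac{x}{x-1},\tfrac{y-1}{x+y-1}\bigr)$. For two such tuples $z=z(x,y)$, $z'=z(x',y')$ put $$R_{z,z'}(X)=\prod_{j\in\mathbb Z/5}\Bigl(X-\sum_{i}z_iz'_{j+i}\Bigr)\Bigl(X-\sum_i z_iz'_{j-i}\Bigr),$$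 and define the degree-$10$ multi-resolvents $F^1_{\mathbf a,\mathbf a'}=R_{z(x,y),\,z(x',y')}$ and $F^2_{\mathbf a,\mathbf a'}=R_{z(\rho(x,y)),\,z(x',y')}$, where $x,y,x',y'\in\overline M$ with $(x,y)\mapsto\mathbf a$ and $(x',y')\mapsto\mathbf a'$. The decomposition type $\mathrm{DT}(F^i_{\mathbf a,\mathbf a'})$ over $M$ is the partition of $10$ given by the degrees of the irreducible factors over $M$ of $F^i_{\mathbf a,\mathbf a'}$ if this polynomial has no repeated factors; in general it is that of $R_{p(z),q(z')}$, where $z,z'$ are the two tuples defining $F^i_{\mathbf a,\mathbf a'}$ and $p,q\in M[X]$ are any polynomials (Tschirnhausen transformations, applied to each entry) for which $R_{p(z),q(z')}\in M[X]$ has no repeated factors. **Theorem.** Let $\mathbf a,\mathbf a'\in M^2$ be such that $f_{\mathbf a}$ and $f_{\mathbf a'}$ are separable and $\#G_{\mathbf a}\ge\#G_{\mathbf a'}>1$. Then $\mathrm{DT}(F^1_{\mathbf a,\mathbf a'})$ and $\mathrm{DT}(F^2_{\mathbf a,\mathbf a'})$ exist and are well defined (independent of $x,y,x',y',p,q$).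 The pair $(G_{\mathbf a},G_{\mathbf a'})$ is, up to isomorphism, one of $(D_5,D_5)$, $(D_5,C_5)$, $(D_5,C_2)$, $(C_5,C_5)$, $(C_5,C_2)$, $(C_2,C_2)$, and for each of these exactly one of the lines of the following table that belong to it holds. Within each line the third, fourth and last columns are equivalent to each other, so that, given $G_{\mathbf a}$ and $G_{\mathbf a'}$, the two decomposition types determine $G_{\mathbf a,\mathbf a'}$ and the relation between $L_{\mathbf a}$ and $L_{\mathbf a'}$. (In $(C_5\times C_5)\rtimes C_2$ the group $C_2$ acts by inversion.) | $G_{\mathbf a}$ | $G_{\mathbf a'}$ | $G_{\mathbf a,\mathbf a'}$ | fields | $\mathrm{DT}(F^1);\ \mathrm{DT}(F^2)$ | |---|---|---|---|---| | $D_5$ | $D_5$ | $D_5\times D_5$ | $L_{\mathbf a}\cap L_{\mathbf a'}=M$ | $10;\ 10$ | | $D_5$ | $D_5$ | $(C_5\times C_5)\rtimes C_2$ | $[L_{\mathbf a}\cap L_{\mathbf a'}:M]=2$ | $5,5;\ 5,5$ | | $D_5$ | $D_5$ | $D_5$ | $L_{\mathbf a}=L_{\mathbf a'}$ | $5,2,2,1;\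 5,5$ or $5,5;\ 5,2,2,1$ | | $D_5$ | $C_5$ | $D_5\times C_5$ | $L_{\mathbf a}\cap L_{\mathbf a'}=M$ | $10;\ 10$ | | $D_5$ | $C_2$ | $D_{10}$ | $L_{\mathbf a}\not\supset L_{\mathbf a'}$ | $10;\ 10$ | | $D_5$ | $C_2$ | $D_5$ | $L_{\mathbf a}\supset L_{\mathbf a'}$ | $5,5;\ 5,5$ | | $C_5$ | $C_5$ | $C_5\times C_5$ | $L_{\mathbf a}\ne L_{\mathbf a'}$ | $5,5;\ 5,5$ | | $C_5$ | $C_5$ | $C_5$ | $L_{\mathbf a}=L_{\mathbf a'}$ | $5,1,1,1,1,1;\ 5,5$ or $5,5;\ 5,1,1,1,1,1$ | | $C_5$ | $C_2$ | $C_{10}$ | $L_{\mathbf a}\cap L_{\mathbf a'}=M$ | $10;\ 10$ | | $C_2$ | $C_2$ | $C_2\times C_2$ | $L_{\mathbf a}\ne L_{\mathbf a'}$ | $4,4,2;\ 4,4,2$ | | $C_2$ | $C_2$ | $C_2$ | $L_{\mathbf a}=L_{\mathbf a'}$ | $2,2,2,2,1,1;\ 2,2,2,2,1,1$ | In particular $L_{\mathbf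 a}=L_{\mathbf a'}$ if and only if $\mathrm{DT}(F^1_{\mathbf a,\mathbf a'})$ or $\mathrm{DT}(F^2_{\mathbf a,\mathbf a'})$ contains $1$. -/

import Mathlib

open Polynomial

noncomputable section

namespace Brumer

variable {M : Type*} [Field M] {K : Type*} [Field K] [Algebra M K]

/-- Brumer's quintic `f_{s,t}(X)`, specialized at a point `a = (s, t)`. -/
def quintic (a : M × M) : M[X] :=
  X ^ 5 + C (a.2 - 3) * X ^ 4 + C (a.1 - a.2 + 3) * X ^ 3
    + C (a.2 ^ 2 - a.2 - 2 * a.1 - 1) * X ^ 2 + C a.1 * X + C a.2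

/-- The five conjugates of `x` under `D₅ = ⟨σ, τ⟩`, in the order `x, σ x, σ² x, σ³ x, σ⁴ x`, where
`σ : x ↦ y, y ↦ (1 - y) / x` and `τ : x ↦ x, y ↦ (1 - x) / y`. Thus `σ` is `i ↦ i + 1` and `τ` is
`i ↦ -i` on the index set `Fin 5` (whose arithmetic is modulo 5). -/
def formalRoots (x y : K) : Fin 5 → K :=
  ![x, y, (1 - y) / x, (x + y - 1) / (x * y), (1 - x) / y]

/-- `(x, y)` is a point of the `(x, y)`-plane lying over the point `a` of the `(s, t)`-plane, that
is, a specialization of the indeterminates `x, y` compatible with `(s, t) ↦ a`. It amounts to an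
ordering of the roots of the quintic for which its Galois group lies in `D₅`. -/
def LiesOver (a : M × M) (x y : K) : Prop :=
  x ≠ 0 ∧ y ≠ 0 ∧
    (quintic a).map (algebraMap M K) = ∏ i : Fin 5, (X - C (formalRoots x y i))

/-- The `D₅ × D₅'`-relative resolvent by `∑ i, zᵢ z'ᵢ`, whose stabilizer is the diagonal `D₅''`.
The ten cosets of `D₅''` are represented by `1 × D₅'`, i.e. by the index maps `i ↦ j + i` and
`i ↦ j - i`. For `z = (x, y, …)`, `z' = (x', y', …)` the sum `∑ i, zᵢ z'ᵢ` is `P`. -/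
def resolvent (z z' : Fin 5 → K) : K[X] :=
  ∏ j : Fin 5, ((X - C (∑ i, z i * z' (j + i))) * (X - C (∑ i, z i * z' (j - i))))

/-- The degrees of the irreducible factors, with multiplicity. -/
def degreeType (F : M[X]) : Multiset ℕ :=
  (UniqueFactorizationMonoid.factors F).map natDegree

variable (M) in
/-- `μ` is the decomposition type over `M` of `resolvent z z'`. If the resolvent has repeated
factors, the type is by definition that of a resolvent without repeated factors obtained after
Tschirnhausen transformations `z ↦ p(z)`, `z' ↦ q(z')` with `p, q ∈ M[X]`
(`p = q = X` leaves the resolvent unchanged). -/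
def IsResolventType (z z' : Fin 5 → K) (μ : Multiset ℕ) : Prop :=
  ∃ (p q F : M[X]),
    F.map (algebraMap M K) = resolvent (fun i => aeval (z i) p) (fun i => aeval (z' i) q) ∧
    Squarefree F ∧ μ = degreeType F

variable (K) in
/-- `μ` is the decomposition type over `M` of `F¹_{a,a'}`, the resolvent by `P`. -/
def IsDT₁ (a a' : M × M) (μ : Multiset ℕ) : Prop :=
  ∃ x y x' y' : K, LiesOver a x y ∧ LiesOver a' x' y' ∧
    IsResolventType M (formalRoots x y) (formalRoots x' y') μ

variable (K) in
/-- `μ` is the decomposition type over `M` of `F²_{a,a'}`, the resolvent by `ρ(P)`, where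
`ρ : x ↦ x / (x - 1), y ↦ (y - 1) / (x + y - 1)` acts on the first pair of variables only. -/
def IsDT₂ (a a' : M × M) (μ : Multiset ℕ) : Prop :=
  ∃ x y x' y' : K, LiesOver a x y ∧ LiesOver a' x' y' ∧
    IsResolventType M (formalRoots (x / (x - 1)) ((y - 1) / (x + y - 1))) (formalRoots x' y') μ

variable (K) in
/-- `L_a`, the splitting field over `M` of the quintic inside `K`. -/
def splittingField (a : M × M) : IntermediateField M K :=
  IntermediateField.adjoin M ((quintic a).rootSet K)

/-- Isomorphism of groups. -/
def Iso (G H : Type*) [Group G] [Group H] : Prop := Nonempty (G ≃* H)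

/-- The cyclic group of order `n`. -/
abbrev Cyc (n : ℕ) : Type := Multiplicative (ZMod n)

/-- The group of order two generated by inversion on `C₅ × C₅`. -/
abbrev inversionGroup : Subgroup (MulAut (Cyc 5 × Cyc 5)) :=
  Subgroup.zpowers (MulEquiv.inv (Cyc 5 × Cyc 5))

/-- `(C₅ × C₅) ⋊ C₂`, where `C₂` acts by inversion. -/
abbrev C5C5C2 : Type := (Cyc 5 × Cyc 5) ⋊[inversionGroup.subtype] inversionGroup

/-- The table answering the intersection problem. `G, G', GG` are the Galois groups `G_a, G_{a'},
G_{a,a'}`, `L, L'` the splitting fields, `μ₁, μ₂` the decomposition types of `F¹, F²`. Each of the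
six blocks is one possible pair `G_a, G_{a'}`; within a block, every line of the table says that its
field-theoretic condition, its group `G_{a,a'}` and its decomposition types are equivalent. -/
def Table (G G' GG : Type*) [Group G] [Group G'] [Group GG] (L L' : IntermediateField M K)
    (μ₁ μ₂ : Multiset ℕ) : Prop :=
  -- `D₅`, `D₅`
  (Iso G (DihedralGroup 5) ∧ Iso G' (DihedralGroup 5) ∧
    (L ⊓ L' = ⊥ ∨ Module.finrank M ↥(L ⊓ L') = 2 ∨ L = L') ∧
    [L ⊓ L' = ⊥,
      Iso GG (DihedralGroup 5 × DihedralGroup 5),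
      μ₁ = {10} ∧ μ₂ = {10}].TFAE ∧
    [Module.finrank M ↥(L ⊓ L') = 2,
      Iso GG C5C5C2,
      μ₁ = {5, 5} ∧ μ₂ = {5, 5}].TFAE ∧
    [L = L',
      Iso GG (DihedralGroup 5),
      (μ₁ = {5, 2, 2, 1} ∧ μ₂ = {5, 5}) ∨ (μ₁ = {5, 5} ∧ μ₂ = {5, 2, 2, 1})].TFAE) ∨
  -- `D₅`, `C₅`
  (Iso G (DihedralGroup 5) ∧ Iso G' (Cyc 5) ∧
    L ⊓ L' = ⊥ ∧
    Iso GG (DihedralGroup 5 × Cyc 5) ∧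
    μ₁ = {10} ∧ μ₂ = {10}) ∨
  -- `D₅`, `C₂`
  (Iso G (DihedralGroup 5) ∧ Iso G' (Cyc 2) ∧
    [¬ L' ≤ L,
      Iso GG (DihedralGroup 10),
      μ₁ = {10} ∧ μ₂ = {10}].TFAE ∧
    [L' ≤ L,
      Iso GG (DihedralGroup 5),
      μ₁ = {5, 5} ∧ μ₂ = {5, 5}].TFAE) ∨
  -- `C₅`, `C₅`
  (Iso G (Cyc 5) ∧ Iso G' (Cyc 5) ∧
    [L ≠ L',
      Iso GG (Cyc 5 × Cyc 5),
      μ₁ = {5, 5} ∧ μ₂ = {5, 5}].TFAE ∧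
    [L = L',
      Iso GG (Cyc 5),
      (μ₁ = {5, 1, 1, 1, 1, 1} ∧ μ₂ = {5, 5}) ∨
        (μ₁ = {5, 5} ∧ μ₂ = {5, 1, 1, 1, 1, 1})].TFAE) ∨
  -- `C₅`, `C₂`
  (Iso G (Cyc 5) ∧ Iso G' (Cyc 2) ∧
    L ⊓ L' = ⊥ ∧
    Iso GG (Cyc 10) ∧
    μ₁ = {10} ∧ μ₂ = {10}) ∨
  -- `C₂`, `C₂`
  (Iso G (Cyc 2) ∧ Iso G' (Cyc 2) ∧
    [L ≠ L',
      Iso GG (Cyc 2 × Cyc 2),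
      μ₁ = {4, 4, 2} ∧ μ₂ = {4, 4, 2}].TFAE ∧
    [L = L',
      Iso GG (Cyc 2),
      μ₁ = {2, 2, 2, 2, 1, 1} ∧ μ₂ = {2, 2, 2, 2, 1, 1}].TFAE)

end Brumer

end

/-!
# Galois groups of products of two Brumer quintics

Let `z = (z₀, …, z₄)` be an ordering of the roots of a separable quintic as in `LiesOver`. The roots
satisfy `zᵢ₋₁ zᵢ₊₁ = 1 - zᵢ` (`IsCycle`), and these relations determine the cyclic order up to
`D₅`: the only other candidate is the order `i ↦ 2 * i`, for which all five roots would share the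
value `zᵢ (1 - zᵢ)²` of a cubic (`IsCycle.exists_act`). Hence the Galois group acts on the indices
through `D₅`, and another choice of ordering only renumbers the factors of the resolvent. An
ordering exists over an algebraic closure (`exists_liesOver`), because a separable quintic has
`t ≠ 0`.

The ten roots `∑ i, p(zᵢ) q(z'_{d i})` of a resolvent are indexed by `d ∈ D₅`, and an
automorphism acting through `g` on `z` and through `g'` on `z'` sends the index `d` to
`g' d g⁻¹`. So, whenever the roots are distinct, the decomposition type is the multiset of
orbit sizes of the image `H ≤ D₅ × D₅` of the Galois group (`isResolventType_iff`); over an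
infinite field suitable `p, q` exist. For the second resolvent the tuple `z` is replaced by
`i ↦ z_{2i} / (z_{2i} - 1)`, which replaces the action of `g` by its image under the
automorphism `twist` of `D₅`.

It remains to list the possible `H`. By Goursat's lemma `H` is governed by the normal subgroup
`N = {h | (1, h) ∈ H}` of the second projection `G'`. If `N = G'` then `H = G × G'`; if `N = 1` then
`H` is the graph of a homomorphism `G → G'`; the only remaining case is `G = G' = D₅`, `N = C₅`,
where `H` consists of the pairs of equal sign. In each case the orbit sizes are found by direct
evaluation, and the Galois correspondence translates the shape of `H` into the relation between the
two splitting fields (`table_of_hom`).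
-/

noncomputable section

namespace Brumer

open DihedralGroup

/-! ### The action of `D₅` on indices -/

/-- The action of `D₅` on the index set `Fin 5`: the rotation `r j` is `i ↦ i + j`, and
`sr j = s * r j` is `i ↦ -(i + j)`. -/
def act : DihedralGroup 5 → Fin 5 → Fin 5
  | .r j, i => i + (show Fin 5 from j)
  | .sr j, i => -(i + (show Fin 5 from j))

/-- The automorphism of `D₅` induced by conjugation with the index map `i ↦ 2 * i`. -/
def twist : DihedralGroup 5 → DihedralGroup 5
  | .r j => .r (3 * j)
  | .sr j => .sr (3 * j)

theorem act_mul : ∀ (g h : DihedralGroup 5) (i : Fin 5), act (g * h) i = act g (act h i) := by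
  decide +kernel

@[simp]
theorem act_one : ∀ i : Fin 5, act 1 i = i := by
  decide +kernel

theorem act_injective : ∀ g : DihedralGroup 5, Function.Injective (act g) := by
  decide +kernel

theorem act_faithful : ∀ g h : DihedralGroup 5, (∀ i, act g i = act h i) → g = h := by
  decide +kernel

theorem twist_mul : ∀ g h : DihedralGroup 5, twist (g * h) = twist g * twist h := by
  decide +kernel

theorem two_mul_act_twist :
    ∀ (g : DihedralGroup 5) (i : Fin 5), 2 * act (twist g) i = act g (2 * i) := by
  decide +kernel

/-- A permutation `π` of the indices lies in `D₅`, or is an element of `D₅` followed by `i ↦ 2 * i`,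
or, for some `i`, the pairs `{π (i - 1), π (i + 1)}` and `{π i - 1, π i + 1}` share exactly one
element `l`. -/
theorem perm_cases : ∀ a b c d e : Fin 5, ![a, b, c, d, e].Injective →
    (∃ g, ∀ i, ![a, b, c, d, e] i = act g i) ∨
    (∃ g, ∀ i, ![a, b, c, d, e] i = 2 * act g i) ∨
    ∃ i j k l, j ≠ k ∧ l ≠ k ∧
      ((![a, b, c, d, e] (i - 1) = l ∧ ![a, b, c, d, e] (i + 1) = j) ∨
        (![a, b, c, d, e] (i - 1) = j ∧ ![a, b, c, d, e] (i + 1) = l)) ∧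
      ((![a, b, c, d, e] i - 1 = l ∧ ![a, b, c, d, e] i + 1 = k) ∨
        (![a, b, c, d, e] i - 1 = k ∧ ![a, b, c, d, e] i + 1 = l)) := by
  decide +kernel

/-! ### Orbits of subgroups of `D₅ × D₅` on `D₅` -/

/-- The orbit of `d` under a set `H` of pairs, the pair `(g, g')` acting by
`d ↦ g' * d * g⁻¹`. -/
def orbitOf (H : Finset (DihedralGroup 5 × DihedralGroup 5)) (d : DihedralGroup 5) :
    Finset (DihedralGroup 5) :=
  H.image fun h => h.2 * d * h.1⁻¹

/-- The orbit sizes of a subgroup `H` of `D₅ × D₅` acting on `D₅` by left and right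
multiplication, as a multiset. -/
def orbitType (H : Finset (DihedralGroup 5 × DihedralGroup 5)) : Multiset ℕ :=
  (Finset.univ.image (orbitOf H)).val.map Finset.card

/-- The set of pairs `H` with the automorphism `twist` applied to the first components. -/
def twistFst (H : Finset (DihedralGroup 5 × DihedralGroup 5)) :
    Finset (DihedralGroup 5 × DihedralGroup 5) :=
  H.image fun h => (twist h.1, h.2)

/-- The cyclic subgroup of rotations in `D₅`. -/
def rotations : Finset (DihedralGroup 5) := Finset.univ.image DihedralGroup.r

/-- The subgroup `{1, s rᵇ}` generated by a reflection. -/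
def reflPair (b : ZMod 5) : Finset (DihedralGroup 5) := {1, .sr b}

theorem orbitType_univ : orbitType (Finset.univ ×ˢ Finset.univ) = {10} ∧
    orbitType (twistFst (Finset.univ ×ˢ Finset.univ)) = {10} := by
  decide +kernel

theorem orbitType_univ_rotations : orbitType (Finset.univ ×ˢ rotations) = {10} ∧
    orbitType (twistFst (Finset.univ ×ˢ rotations)) = {10} := by
  decide +kernel

theorem orbitType_univ_reflPair (b : ZMod 5) :
    orbitType (Finset.univ ×ˢ reflPair b) = {10} ∧
    orbitType (twistFst (Finset.univ ×ˢ reflPair b)) = {10} := by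
  revert b
  decide +kernel

theorem orbitType_rotations : orbitType (rotations ×ˢ rotations) = {5, 5} ∧
    orbitType (twistFst (rotations ×ˢ rotations)) = {5, 5} := by
  decide +kernel

theorem orbitType_rotations_reflPair (b : ZMod 5) :
    orbitType (rotations ×ˢ reflPair b) = {10} ∧
    orbitType (twistFst (rotations ×ˢ reflPair b)) = {10} := by
  revert b
  decide +kernel

theorem orbitType_reflPair (b c : ZMod 5) :
    orbitType (reflPair b ×ˢ reflPair c) = {4, 4, 2} ∧
    orbitType (twistFst (reflPair b ×ˢ reflPair c)) = {4, 4, 2} := by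
  revert b c
  decide +kernel

theorem orbitType_diag_reflPair (b c : ZMod 5) :
    orbitType {(1, 1), (sr b, sr c)} = {2, 2, 2, 2, 1, 1} ∧
    orbitType (twistFst {(1, 1), (sr b, sr c)}) = {2, 2, 2, 2, 1, 1} := by
  revert b c
  decide +kernel

theorem orbitType_graph_rotations (k : ZMod 5) (hk : k ≠ 0) :
    (orbitType (Finset.univ.image fun i : ZMod 5 => (r i, r (k * i))) = {5, 1, 1, 1, 1, 1} ∧
      orbitType (twistFst (Finset.univ.image fun i : ZMod 5 => (r i, r (k * i)))) = {5, 5}) ∨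
    (orbitType (Finset.univ.image fun i : ZMod 5 => (r i, r (k * i))) = {5, 5} ∧
      orbitType (twistFst (Finset.univ.image fun i : ZMod 5 => (r i, r (k * i))))
        = {5, 1, 1, 1, 1, 1}) := by
  revert k
  decide +kernel

/-- The set of pairs `(g, ψ g)` where `ψ (r i) = r (k * i)` and `ψ (s r i) = s r (b + k * i)`. -/
def graphAut (k b : ZMod 5) : Finset (DihedralGroup 5 × DihedralGroup 5) :=
  (Finset.univ.image fun i : ZMod 5 => (r i, r (k * i))) ∪
    Finset.univ.image fun i : ZMod 5 => (sr i, sr (b + k * i))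

theorem orbitType_graphAut (k b : ZMod 5) (hk : k ≠ 0) :
    (orbitType (graphAut k b) = {5, 2, 2, 1} ∧ orbitType (twistFst (graphAut k b)) = {5, 5}) ∨
    (orbitType (graphAut k b) = {5, 5} ∧
      orbitType (twistFst (graphAut k b)) = {5, 2, 2, 1}) := by
  revert k b
  decide +kernel

/-- The set of pairs `(g, ε g)` where `ε` maps rotations to `1` and reflections to `s rᵇ`. -/
def graphSign (b : ZMod 5) : Finset (DihedralGroup 5 × DihedralGroup 5) :=
  (Finset.univ.image fun i : ZMod 5 => (r i, 1)) ∪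
    Finset.univ.image fun i : ZMod 5 => (sr i, sr b)

theorem orbitType_graphSign (b : ZMod 5) :
    orbitType (graphSign b) = {5, 5} ∧ orbitType (twistFst (graphSign b)) = {5, 5} := by
  revert b
  decide +kernel

/-- The pairs in `D₅ × D₅` whose components are both rotations or both reflections. -/
def sameSign : Finset (DihedralGroup 5 × DihedralGroup 5) :=
  (rotations ×ˢ rotations) ∪
    (Finset.univ.image DihedralGroup.sr ×ˢ Finset.univ.image DihedralGroup.sr)

theorem orbitType_sameSign :
    orbitType sameSign = {5, 5} ∧ orbitType (twistFst sameSign) = {5, 5} := by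
  decide +kernel

/-! ### The image of a pair of homomorphisms -/

section PairSet

variable {Γ : Type*} [Group Γ] (φ φ' : Γ →* DihedralGroup 5)

open Classical in
/-- The image of `(φ, φ') : Γ → D₅ × D₅`. -/
def pairSet : Finset (DihedralGroup 5 × DihedralGroup 5) :=
  Finset.univ.filter fun u => ∃ g, φ g = u.1 ∧ φ' g = u.2

theorem mem_pairSet {u : DihedralGroup 5 × DihedralGroup 5} :
    u ∈ pairSet φ φ' ↔ ∃ g, φ g = u.1 ∧ φ' g = u.2 := by
  simp [pairSet]

theorem mem_orbitOf {d e : DihedralGroup 5} :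
    e ∈ orbitOf (pairSet φ φ') d ↔ ∃ g, φ' g * d * (φ g)⁻¹ = e := by
  simp only [orbitOf, Finset.mem_image, mem_pairSet]
  constructor
  · rintro ⟨⟨u, v⟩, ⟨g, rfl, rfl⟩, rfl⟩
    exact ⟨g, rfl⟩
  · rintro ⟨g, rfl⟩
    exact ⟨(φ g, φ' g), ⟨g, rfl, rfl⟩, rfl⟩

theorem orbitOf_eq_iff {d e : DihedralGroup 5} :
    orbitOf (pairSet φ φ') e = orbitOf (pairSet φ φ') d ↔ e ∈ orbitOf (pairSet φ φ') d := by
  constructor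
  · intro h
    rw [← h, mem_orbitOf]
    exact ⟨1, by simp⟩
  · rw [mem_orbitOf]
    rintro ⟨g, rfl⟩
    ext x
    simp only [mem_orbitOf]
    constructor
    · rintro ⟨k, rfl⟩
      exact ⟨k * g, by simp [mul_assoc]⟩
    · rintro ⟨k, rfl⟩
      exact ⟨k * g⁻¹, by simp [mul_assoc]⟩

end PairSet

/-! ### Decomposition types as orbit sizes -/

section DegreeType

variable {M E : Type*} [Field M] [Field E] [Algebra M E]

theorem degreeType_prod_of_irreducible {ι : Type*} (s : Finset ι) (f : ι → M[X])
    (hf : ∀ i ∈ s, Irreducible (f i)) :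
    degreeType (∏ i ∈ s, f i) = s.val.map fun i => (f i).natDegree := by
  have h0 : ∏ i ∈ s, f i ≠ 0 := Finset.prod_ne_zero_iff.2 fun i hi => (hf i hi).ne_zero
  have hrel : Multiset.Rel Associated (UniqueFactorizationMonoid.factors (∏ i ∈ s, f i))
      (s.val.map f) := by
    apply UniqueFactorizationMonoid.factors_unique
    · exact fun x hx => UniqueFactorizationMonoid.irreducible_of_factor x hx
    · intro x hx
      obtain ⟨i, hi, rfl⟩ := Multiset.mem_map.1 hx
      exact hf i hi
    · exact UniqueFactorizationMonoid.factors_prod h0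
  rw [degreeType]
  have : ∀ a b : Multiset M[X], Multiset.Rel Associated a b →
      a.map natDegree = b.map natDegree := by
    intro a b h
    induction h with
    | zero => rfl
    | cons hab _ ih =>
      rw [Multiset.map_cons, Multiset.map_cons, ih,
        natDegree_eq_of_degree_eq (degree_eq_degree_of_associated hab)]
  rw [this _ _ hrel, Multiset.map_map]
  rfl

variable [IsGalois M E]
  (φ φ' : (E ≃ₐ[M] E) →* DihedralGroup 5) {ρ : DihedralGroup 5 → E}
  (hρ : ∀ g d, g (ρ d) = ρ (φ' g * d * (φ g)⁻¹))

include hρ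

/-- The conjugates of `ρ d` are the `ρ e` with `e` in the orbit of `d`. -/
theorem map_minpoly_eq_prod_orbitOf (hinj : ρ.Injective) (d : DihedralGroup 5) :
    (minpoly M (ρ d)).map (algebraMap M E) =
      ∏ e ∈ orbitOf (pairSet φ φ') d, (X - C (ρ e)) := by
  classical
  have hsep : ((minpoly M (ρ d)).map (algebraMap M E)).Separable :=
    Polynomial.Separable.map (IsGalois.separable M (ρ d))
  have hspl : ((minpoly M (ρ d)).map (algebraMap M E)).Splits := IsGalois.splits M (ρ d)
  have hmonic : ((minpoly M (ρ d)).map (algebraMap M E)).Monic :=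
    (minpoly.monic (IsGalois.integral M (ρ d))).map _
  have hroots : ((minpoly M (ρ d)).map (algebraMap M E)).roots =
      ((orbitOf (pairSet φ φ') d).image ρ).val := by
    refine (Multiset.Nodup.ext (nodup_roots hsep) (Finset.nodup _)).2 fun x => ?_
    rw [mem_roots hmonic.ne_zero, IsRoot.def, eval_map_algebraMap, Finset.mem_val,
      Finset.mem_image]
    constructor
    · intro hx
      have : IsConjRoot M (ρ d) x :=
        (isConjRoot_iff_aeval_eq_zero (IsGalois.integral M (ρ d))).2 hx
      obtain ⟨g, hg⟩ := isConjRoot_iff_exists_algEquiv.1 this.symm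
      exact ⟨_, (mem_orbitOf φ φ').2 ⟨g, rfl⟩, by rw [← hρ, hg]⟩
    · rintro ⟨e, he, rfl⟩
      obtain ⟨g, rfl⟩ := (mem_orbitOf φ φ').1 he
      rw [← hρ, ← AlgEquiv.coe_toAlgHom, aeval_algHom_apply, minpoly.aeval, map_zero]
  rw [hspl.eq_prod_roots_of_monic hmonic, hroots]
  change ∏ x ∈ (orbitOf (pairSet φ φ') d).image ρ, (X - C x) = _
  rw [Finset.prod_image fun _ _ _ _ h => hinj h]

/-- If the Galois group permutes the distinct roots `ρ d`, `d ∈ D₅`, of `F` through left and right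
multiplication, then the irreducible factors of `F` correspond to the orbits. -/
theorem exists_prod_eq_and_degreeType (hinj : ρ.Injective) :
    ∃ F : M[X], F.map (algebraMap M E) = ∏ d, (X - C (ρ d)) ∧
      degreeType F = orbitType (pairSet φ φ') := by
  classical
  have hrep : ∀ o ∈ Finset.univ.image (orbitOf (pairSet φ φ')),
      ∃ d, orbitOf (pairSet φ φ') d = o := by
    simp
  choose! rep hrep using hrep
  refine ⟨∏ o ∈ Finset.univ.image (orbitOf (pairSet φ φ')), minpoly M (ρ (rep o)), ?_, ?_⟩
  · rw [Polynomial.map_prod, ← Finset.prod_fiberwise_of_maps_to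
      (fun d _ => Finset.mem_image_of_mem (orbitOf (pairSet φ φ')) (Finset.mem_univ d))]
    refine Finset.prod_congr rfl fun o ho => ?_
    rw [map_minpoly_eq_prod_orbitOf φ φ' hρ hinj]
    refine Finset.prod_congr ?_ fun _ _ => rfl
    ext e
    simp only [Finset.mem_filter, Finset.mem_univ, true_and]
    rw [← orbitOf_eq_iff, hrep o ho]
  · rw [degreeType_prod_of_irreducible _ _
      fun o _ => minpoly.irreducible (IsGalois.integral M _), orbitType]
    refine Multiset.map_congr rfl fun o ho => ?_
    rw [← natDegree_map (algebraMap M E), map_minpoly_eq_prod_orbitOf φ φ' hρ hinj,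
      natDegree_prod_of_monic _ _ fun _ _ => monic_X_sub_C _, hrep o ho]
    simp

omit hρ in
/-- Over a Galois extension in which it splits, a squarefree polynomial has distinct roots. -/
theorem injective_of_squarefree {ι : Type*} [Fintype ι] {ρ : ι → E} {F : M[X]}
    (hF : F.map (algebraMap M E) = ∏ d, (X - C (ρ d))) (hsq : Squarefree F) :
    ρ.Injective := by
  classical
  intro d e hde
  by_contra hne
  have hdvd : minpoly M (ρ d) ∣ F := by
    apply minpoly.dvd
    rw [← eval_map_algebraMap, hF, eval_prod]
    exact Finset.prod_eq_zero (Finset.mem_univ d) (by simp)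
  obtain ⟨u, hu⟩ := hdvd
  have hsep : ((minpoly M (ρ d)).map (algebraMap M E)).Separable :=
    Polynomial.Separable.map (IsGalois.separable M (ρ d))
  have hu0 : aeval (ρ d) u ≠ 0 := by
    intro h
    obtain ⟨v, hv⟩ := minpoly.dvd M (ρ d) h
    refine minpoly.not_isUnit M (ρ d) (hsq _ ⟨v, ?_⟩)
    rw [hu, hv, mul_assoc]
  -- the minimal polynomial contributes `ρ d` once, its cofactor not at all
  have hsq2 : (X - C (ρ d)) ^ 2 ∣ F.map (algebraMap M E) := by
    rw [hF, ← Finset.mul_prod_erase _ _ (Finset.mem_univ d),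
      ← Finset.mul_prod_erase _ _ (Finset.mem_erase.2 ⟨fun h => hne h.symm, Finset.mem_univ e⟩),
      ← mul_assoc, ← hde, ← sq]
    exact dvd_mul_right _ _
  rw [hu, Polynomial.map_mul] at hsq2
  have hcop : IsCoprime ((X - C (ρ d)) ^ 2) (u.map (algebraMap M E)) := by
    refine IsCoprime.pow_left ?_
    refine (irreducible_X_sub_C _).coprime_iff_not_dvd.2 ?_
    rwa [dvd_iff_isRoot, IsRoot.def, eval_map_algebraMap]
  have h2 := hcop.dvd_of_dvd_mul_right hsq2
  exact not_isUnit_X_sub_C (ρ d) (hsep.squarefree _ (by rwa [← sq]))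

theorem degreeType_eq_orbitType {F : M[X]}
    (hF : F.map (algebraMap M E) = ∏ d, (X - C (ρ d))) (hsq : Squarefree F) :
    degreeType F = orbitType (pairSet φ φ') := by
  obtain ⟨F', hF', hd⟩ := exists_prod_eq_and_degreeType φ φ' hρ (injective_of_squarefree hF hsq)
  rw [← hd, map_injective _ (algebraMap M E).injective (hF.trans hF'.symm)]

end DegreeType

/-! ### Resolvents as products over `D₅` -/

section Resolvent

/-- The index map `act g` as a permutation. -/
def actEquiv (g : DihedralGroup 5) : Equiv.Perm (Fin 5) :=
  Equiv.ofBijective (act g) (Finite.injective_iff_bijective.1 (act_injective g))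

@[simp]
theorem actEquiv_apply (g : DihedralGroup 5) (i : Fin 5) : actEquiv g i = act g i := rfl

/-- The roots `∑ i, zᵢ z'_{d i}` of the resolvent, indexed by `d ∈ D₅`. -/
def rootSum {R : Type*} [CommSemiring R] (z z' : Fin 5 → R) (d : DihedralGroup 5) : R :=
  ∑ i, z i * z' (act d i)

/-- Renumbering `z` by `g` and `z'` by `g'` moves the index `d` to `g' * d * g⁻¹`. -/
theorem rootSum_comp {R : Type*} [CommSemiring R] (z z' : Fin 5 → R)
    (g g' d : DihedralGroup 5) :
    rootSum (fun i => z (act g i)) (fun i => z' (act g' i)) d = rootSum z z' (g' * d * g⁻¹) := by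
  unfold rootSum
  rw [← Equiv.sum_comp (actEquiv g) fun i => z i * z' (act (g' * d * g⁻¹) i)]
  refine Finset.sum_congr rfl fun i _ => ?_
  simp only [actEquiv_apply, ← act_mul, inv_mul_cancel_right]

theorem prod_dihedral {R : Type*} [CommMonoid R] (f : DihedralGroup 5 → R) :
    ∏ d, f d = ∏ j : Fin 5, (f (r (show ZMod 5 from j)) * f (sr (show ZMod 5 from -j))) := by
  have hb : Function.Bijective (Sum.elim (fun j : Fin 5 => r (show ZMod 5 from j))
      (fun j : Fin 5 => sr (show ZMod 5 from -j))) := by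
    decide +kernel
  rw [← Equiv.prod_comp (Equiv.ofBijective _ hb) f, Fintype.prod_sum_type,
    Finset.prod_mul_distrib]
  rfl

theorem act_r_apply (i j : Fin 5) : act (r (show ZMod 5 from j)) i = j + i := add_comm _ _

theorem act_sr_neg_apply : ∀ i j : Fin 5, act (sr (show ZMod 5 from -j)) i = j - i := by
  decide +kernel

theorem resolvent_eq {K : Type*} [Field K] (z z' : Fin 5 → K) :
    resolvent z z' = ∏ d, (X - C (rootSum z z' d)) := by
  rw [prod_dihedral]
  simp only [rootSum, act_r_apply, act_sr_neg_apply]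
  rfl

/-- Renumbering either tuple by an element of `D₅` does not change the resolvent. -/
theorem resolvent_comp_act {K : Type*} [Field K] (z z' : Fin 5 → K) (g g' : DihedralGroup 5) :
    resolvent (fun i => z (act g i)) (fun i => z' (act g' i)) = resolvent z z' := by
  rw [resolvent_eq, resolvent_eq,
    ← Equiv.prod_comp ((Equiv.mulLeft g').trans (Equiv.mulRight g⁻¹))
      fun d => X - C (rootSum z z' d)]
  refine Finset.prod_congr rfl fun d _ => ?_
  rw [rootSum_comp]
  rfl

theorem isResolventType_comp_act {M K : Type*} [Field M] [Field K] [Algebra M K]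
    (z z' : Fin 5 → K) (g g' : DihedralGroup 5) (μ : Multiset ℕ) :
    IsResolventType M (fun i => z (act g i)) (fun i => z' (act g' i)) μ ↔
      IsResolventType M z z' μ := by
  refine exists_congr fun p => exists_congr fun q => exists_congr fun F => ?_
  rw [show resolvent (fun i => aeval (z (act g i)) p) (fun i => aeval (z' (act g' i)) q) = _ from
    resolvent_comp_act (fun i => aeval (z i) p) (fun i => aeval (z' i) q) g g']

variable {M E K : Type*} [Field M] [Field E] [Algebra M E]

/-- Over an infinite field some transformation of one tuple makes all `∑ i, p(zᵢ) z'_{d i}`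
distinct: each coincidence cuts out a proper subspace of polynomials `p`, by the
nonvanishing of the Vandermonde determinant. -/
theorem exists_rootSum_injective [Infinite M] {z z' : Fin 5 → E} (hz : z.Injective)
    (hz' : z'.Injective) :
    ∃ p : M[X], (rootSum (fun i => aeval (z i) p) z').Injective := by
  let W : (Fin 5 → E) → Submodule M M[X] := fun v =>
    LinearMap.ker (∑ i, (LinearMap.mulRight M (v i)).comp (aeval (z i)).toLinearMap)
  have hW : ∀ v p, p ∈ W v ↔ ∑ i, aeval (z i) p * v i = 0 := fun v p => by
    simp [W, LinearMap.sum_apply]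
  have hne : ∀ u : {u : DihedralGroup 5 × DihedralGroup 5 // u.1 ≠ u.2},
      W (fun i => z' (act u.1.1 i) - z' (act u.1.2 i)) ≠ ⊤ := by
    rintro ⟨⟨d, e⟩, hde⟩ htop
    refine hde (act_faithful _ _ fun i => hz' (sub_eq_zero.1 ?_))
    refine congrFun (Matrix.eq_zero_of_forall_pow_sum_mul_pow_eq_zero hz (v := fun i =>
      z' (act d i) - z' (act e i)) fun k => ?_) i
    have : (X ^ (k : ℕ) : M[X]) ∈ W fun i => z' (act d i) - z' (act e i) := by
      rw [htop]
      trivial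
    rw [hW] at this
    simpa [mul_comm] using this
  obtain ⟨p, hp⟩ := Submodule.exists_forall_notMem_of_forall_ne_top _ hne
  refine ⟨p, fun d e hde => ?_⟩
  by_contra h
  refine hp ⟨(d, e), h⟩ ((hW _ _).2 ?_)
  simp only [mul_sub, Finset.sum_sub_distrib]
  exact sub_eq_zero.2 hde

variable [Field K] [Algebra M K] [Algebra E K] [IsScalarTower M E K]

theorem resolvent_algebraMap (z z' : Fin 5 → E) (p q : M[X]) :
    resolvent (fun i => aeval (algebraMap E K (z i)) p) (fun i => aeval (algebraMap E K (z' i)) q)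
      = (∏ d, (X - C (rootSum (fun i => aeval (z i) p) (fun i => aeval (z' i) q) d))).map
        (algebraMap E K) := by
  rw [resolvent_eq, Polynomial.map_prod]
  simp only [rootSum, aeval_algebraMap_apply, Polynomial.map_sub, map_X, map_C, ← map_mul,
    ← map_sum]

/-- The decomposition type of a resolvent exists, and is given by the orbit sizes of the Galois
group on `D₅`, whatever the Tschirnhausen transformations. -/
theorem isResolventType_iff [Infinite M] [IsGalois M E]
    (φ φ' : (E ≃ₐ[M] E) →* DihedralGroup 5) {z z' : Fin 5 → E} (hz : z.Injective)
    (hz' : z'.Injective) (hφ : ∀ g i, g (z i) = z (act (φ g) i))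
    (hφ' : ∀ g i, g (z' i) = z' (act (φ' g) i)) (μ : Multiset ℕ) :
    IsResolventType M (fun i => algebraMap E K (z i)) (fun i => algebraMap E K (z' i)) μ ↔
      μ = orbitType (pairSet φ φ') := by
  have hρ : ∀ (p q : M[X]) (g : E ≃ₐ[M] E) (d : DihedralGroup 5),
      g (rootSum (fun i => aeval (z i) p) (fun i => aeval (z' i) q) d) =
        rootSum (fun i => aeval (z i) p) (fun i => aeval (z' i) q) (φ' g * d * (φ g)⁻¹) := by
    intro p q g d
    rw [← rootSum_comp (fun i => aeval (z i) p) (fun i => aeval (z' i) q)]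
    have h : ∀ (x : E) (f : M[X]), g (aeval x f) = aeval (g x) f := fun x f =>
      (aeval_algHom_apply (g : E →ₐ[M] E) x f).symm
    simp [rootSum, h, hφ, hφ']
  constructor
  · rintro ⟨p, q, F, hF, hsq, rfl⟩
    rw [resolvent_algebraMap, IsScalarTower.algebraMap_eq M E K, ← Polynomial.map_map] at hF
    exact degreeType_eq_orbitType φ φ' (hρ p q) (map_injective _ (algebraMap E K).injective hF) hsq
  · rintro rfl
    obtain ⟨p, hp⟩ := exists_rootSum_injective (M := M) hz hz'
    have hp' : (rootSum (fun i => aeval (z i) p) (fun i => aeval (z' i) (X : M[X]))).Injective := by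
      simpa using hp
    obtain ⟨F, hF, hd⟩ := exists_prod_eq_and_degreeType φ φ' (hρ p X) hp'
    refine ⟨p, X, F, ?_, ?_, hd.symm⟩
    · rw [resolvent_algebraMap, IsScalarTower.algebraMap_eq M E K, ← Polynomial.map_map, hF]
    · refine Separable.squarefree (separable_map (algebraMap M E) |>.1 ?_)
      rw [hF]
      exact separable_prod_X_sub_C_iff.2 hp'

end Resolvent

/-! ### The roots of Brumer's quintic -/

section Roots

variable {K : Type*} [Field K]

/-- A 5-cycle of elements with `zᵢ₋₁ zᵢ₊₁ = 1 - zᵢ`, the relations between the formal roots. -/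
def IsCycle (z : Fin 5 → K) : Prop := ∀ i, z (i - 1) * z (i + 1) = 1 - z i

theorem isCycle_iff {z : Fin 5 → K} :
    IsCycle z ↔ z 4 * z 1 = 1 - z 0 ∧ z 0 * z 2 = 1 - z 1 ∧ z 1 * z 3 = 1 - z 2 ∧
      z 2 * z 4 = 1 - z 3 ∧ z 3 * z 0 = 1 - z 4 := by
  simp only [IsCycle, Fin.forall_fin_succ, IsEmpty.forall_iff, and_true]
  exact Iff.rfl

theorem isCycle_formalRoots {x y : K} (hx : x ≠ 0) (hy : y ≠ 0) :
    IsCycle (formalRoots x y) := by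
  rw [isCycle_iff]
  simp only [formalRoots, Matrix.cons_val]
  refine ⟨?_, ?_, ?_, ?_, ?_⟩ <;> field_simp <;> ring

theorem IsCycle.ne_zero {z : Fin 5 → K} (h : IsCycle z) (hz : z.Injective) (i : Fin 5) :
    z i ≠ 0 := by
  intro h0
  have h1 := h (i + 1)
  have h2 := h (i - 1)
  rw [add_sub_cancel_right, h0, zero_mul] at h1
  rw [sub_add_cancel, h0, mul_zero] at h2
  have : i + 1 = i - 1 := hz (by linear_combination h1 - h2)
  clear h1 h2 h0
  revert i
  decide

theorem IsCycle.ne_one {z : Fin 5 → K} (h : IsCycle z) (hz : z.Injective) (i : Fin 5) :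
    z i ≠ 1 := by
  intro h1
  have := h i
  rw [h1, sub_self] at this
  exact (mul_ne_zero (h.ne_zero hz _) (h.ne_zero hz _)) this

/-- If both `z` and `i ↦ z (2 * i)` were cycles, then `zᵢ (1 - zᵢ)²` would be the product of all
the entries, for every `i`, which leaves room for only three distinct values. -/
theorem IsCycle.not_isCycle_two_mul {z : Fin 5 → K} (h : IsCycle z) (hz : z.Injective) :
    ¬ IsCycle fun i => z (2 * i) := by
  intro h2
  rw [isCycle_iff] at h h2
  obtain ⟨a0, a1, a2, a3, a4⟩ := h
  obtain ⟨b0, b1, b2, b3, b4⟩ := h2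
  change z 3 * z 2 = 1 - z 0 at b0
  change z 0 * z 4 = 1 - z 2 at b1
  change z 2 * z 1 = 1 - z 4 at b2
  change z 4 * z 3 = 1 - z 1 at b3
  change z 1 * z 0 = 1 - z 3 at b4
  have e0 : z 0 * (1 - z 0) ^ 2 = z 0 * z 1 * z 2 * z 3 * z 4 := by
    rw [sq]; nth_rw 1 [← a0]; rw [← b0]; ring
  have e1 : z 1 * (1 - z 1) ^ 2 = z 0 * z 1 * z 2 * z 3 * z 4 := by
    rw [sq]; nth_rw 1 [← a1]; rw [← b3]; ring
  have e2 : z 2 * (1 - z 2) ^ 2 = z 0 * z 1 * z 2 * z 3 * z 4 := by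
    rw [sq]; nth_rw 1 [← a2]; rw [← b1]; ring
  have e3 : z 3 * (1 - z 3) ^ 2 = z 0 * z 1 * z 2 * z 3 * z 4 := by
    rw [sq]; nth_rw 1 [← a3]; rw [← b4]; ring
  have ne : ∀ i j : Fin 5, i ≠ j → z i - z j ≠ 0 := fun i j hij =>
    sub_ne_zero.2 fun e => hij (hz e)
  -- first and second divided differences of the cubic `u (1 - u)²` vanish
  have d01 : z 0 ^ 2 + z 0 * z 1 + z 1 ^ 2 - 2 * (z 0 + z 1) + 1 = 0 :=
    (mul_eq_zero.1 (by linear_combination e0 - e1 :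
      (z 0 - z 1) * (z 0 ^ 2 + z 0 * z 1 + z 1 ^ 2 - 2 * (z 0 + z 1) + 1) = 0)).resolve_left
      (ne 0 1 (by decide))
  have d02 : z 0 ^ 2 + z 0 * z 2 + z 2 ^ 2 - 2 * (z 0 + z 2) + 1 = 0 :=
    (mul_eq_zero.1 (by linear_combination e0 - e2 :
      (z 0 - z 2) * (z 0 ^ 2 + z 0 * z 2 + z 2 ^ 2 - 2 * (z 0 + z 2) + 1) = 0)).resolve_left
      (ne 0 2 (by decide))
  have d03 : z 0 ^ 2 + z 0 * z 3 + z 3 ^ 2 - 2 * (z 0 + z 3) + 1 = 0 :=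
    (mul_eq_zero.1 (by linear_combination e0 - e3 :
      (z 0 - z 3) * (z 0 ^ 2 + z 0 * z 3 + z 3 ^ 2 - 2 * (z 0 + z 3) + 1) = 0)).resolve_left
      (ne 0 3 (by decide))
  have f12 : z 0 + z 1 + z 2 - 2 = 0 :=
    (mul_eq_zero.1 (by linear_combination d01 - d02 :
      (z 1 - z 2) * (z 0 + z 1 + z 2 - 2) = 0)).resolve_left (ne 1 2 (by decide))
  have f13 : z 0 + z 1 + z 3 - 2 = 0 :=
    (mul_eq_zero.1 (by linear_combination d01 - d03 :
      (z 1 - z 3) * (z 0 + z 1 + z 3 - 2) = 0)).resolve_left (ne 1 3 (by decide))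
  exact ne 2 3 (by decide) (by linear_combination f12 - f13)

theorem IsCycle.comp_act {z : Fin 5 → K} (h : IsCycle z) (g : DihedralGroup 5) :
    IsCycle fun i => z (act g i) := by
  intro i
  have key : ∀ (g : DihedralGroup 5) (i : Fin 5),
      (act g (i - 1) = act g i - 1 ∧ act g (i + 1) = act g i + 1) ∨
      (act g (i - 1) = act g i + 1 ∧ act g (i + 1) = act g i - 1) := by
    decide +kernel
  rcases key g i with ⟨h1, h2⟩ | ⟨h1, h2⟩
  · simp only [h1, h2, h (act g i)]
  · simp only [h1, h2, mul_comm (z (act g i + 1)), h (act g i)]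

/-- Two arrangements in a cycle of the same five elements differ by an element of `D₅`. -/
theorem IsCycle.exists_act {z w : Fin 5 → K} (hz : IsCycle z) (hw : IsCycle w)
    (hzi : z.Injective) (hwi : w.Injective) (hr : ∀ i, ∃ j, w i = z j) :
    ∃ g, ∀ i, w i = z (act g i) := by
  choose π hπ using hr
  have hπi : π.Injective := fun i j h => hwi (by rw [hπ, hπ, h])
  have hvec : π = ![π 0, π 1, π 2, π 3, π 4] := by
    ext i
    fin_cases i <;> rfl
  have hcases := perm_cases (π 0) (π 1) (π 2) (π 3) (π 4) (hvec ▸ hπi)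
  rw [← hvec] at hcases
  rcases hcases with ⟨g, hg⟩ | ⟨g, hg⟩ | ⟨i, j, k, l, hjk, -, h1, h2⟩
  · exact ⟨g, fun i => by rw [hπ, hg]⟩
  · exfalso
    have hw' := hw.comp_act g⁻¹
    refine hz.not_isCycle_two_mul hzi ?_
    convert hw' using 2 with i
    rw [hπ, hg, ← act_mul, mul_inv_cancel, act_one]
  · exfalso
    have e1 : z l * z j = 1 - z (π i) := by
      have := hw i
      rw [hπ, hπ (i + 1), hπ i] at this
      rcases h1 with ⟨e, f⟩ | ⟨e, f⟩ <;> rw [e, f] at this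
      · exact this
      · rw [mul_comm, this]
    have e2 : z l * z k = 1 - z (π i) := by
      have := hz (π i)
      rcases h2 with ⟨e, f⟩ | ⟨e, f⟩ <;> rw [e, f] at this
      · exact this
      · rw [mul_comm, this]
    exact hjk (hzi (mul_left_cancel₀ (hz.ne_zero hzi l) (e1.trans e2.symm)))

/-- The Möbius transformation by which `ρ` acts on the entries of the tuple. -/
def moebius (u : K) : K := u / (u - 1)

theorem eq_of_moebius_eq {u v : K} (hu : u ≠ 1) (hv : v ≠ 1) (h : moebius u = moebius v) :
    u = v := by
  unfold moebius at h
  rw [div_eq_div_iff (sub_ne_zero.2 hu) (sub_ne_zero.2 hv)] at h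
  linear_combination -h

/-- The transformation `ρ` amounts to a Möbius transformation of the entries followed by the
renumbering `i ↦ 2 * i`. -/
theorem formalRoots_rho {x y : K} (hx : x ≠ 0) (hy : y ≠ 0)
    (hi : (formalRoots x y).Injective) :
    formalRoots (x / (x - 1)) ((y - 1) / (x + y - 1)) =
      fun i => moebius (formalRoots x y (2 * i)) := by
  have hc := isCycle_formalRoots hx hy
  have h2 : (1 - y) / x ≠ 0 := hc.ne_zero hi 2
  have h3 : (x + y - 1) / (x * y) ≠ 0 := hc.ne_zero hi 3
  have h4 : (1 - x) / y ≠ 0 := hc.ne_zero hi 4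
  have hy1 : y - 1 ≠ 0 := fun h => h2 (by rw [show 1 - y = -(y - 1) by ring, h]; simp)
  have hx1 : x - 1 ≠ 0 := fun h => h4 (by rw [show 1 - x = -(x - 1) by ring, h]; simp)
  have hxy : x + y - 1 ≠ 0 := fun h => h3 (by rw [h]; simp)
  have e2 : (1 - y) / x - 1 ≠ 0 := sub_ne_zero.2 (hc.ne_one hi 2)
  have e3 : (x + y - 1) / (x * y) - 1 ≠ 0 := sub_ne_zero.2 (hc.ne_one hi 3)
  have e4 : (1 - x) / y - 1 ≠ 0 := sub_ne_zero.2 (hc.ne_one hi 4)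
  have q2 : (1 - y) / x - 1 = -(x + y - 1) / x := by field_simp; ring
  have q3 : (x + y - 1) / (x * y) - 1 = -((x - 1) * (y - 1)) / (x * y) := by field_simp; ring
  have q4 : (1 - x) / y - 1 = -(x + y - 1) / y := by field_simp; ring
  funext i
  fin_cases i
  · rfl
  · change (y - 1) / (x + y - 1) = (1 - y) / x / ((1 - y) / x - 1)
    rw [q2]; field_simp; ring
  · change (1 - (y - 1) / (x + y - 1)) / (x / (x - 1)) = (1 - x) / y / ((1 - x) / y - 1)
    rw [q4]; field_simp; ring
  · change (x / (x - 1) + (y - 1) / (x + y - 1) - 1) / (x / (x - 1) * ((y - 1) / (x + y - 1))) =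
      y / (y - 1)
    field_simp; ring
  · change (1 - x / (x - 1)) / ((y - 1) / (x + y - 1)) =
      (x + y - 1) / (x * y) / ((x + y - 1) / (x * y) - 1)
    rw [q3]; field_simp; ring

theorem map_formalRoots {L : Type*} [Field L] (f : K →+* L) (x y : K) (i : Fin 5) :
    formalRoots (f x) (f y) i = f (formalRoots x y i) := by
  fin_cases i <;> simp [formalRoots]

end Roots

section LiesOver

variable {M : Type*} [Field M] {K : Type*} [Field K] [Algebra M K] {a : M × M}

theorem LiesOver.isCycle {x y : K} (h : LiesOver a x y) : IsCycle (formalRoots x y) :=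
  isCycle_formalRoots h.1 h.2.1

theorem LiesOver.injective {x y : K} (h : LiesOver a x y) (ha : (quintic a).Separable) :
    (formalRoots x y).Injective := by
  have := ha.map (f := algebraMap M K)
  rw [h.2.2] at this
  exact separable_prod_X_sub_C_iff.1 this

theorem quintic_ne_zero (a : M × M) : quintic a ≠ 0 := by
  intro h
  have : (quintic a).coeff 5 = 1 := by
    simp only [quintic, coeff_add, coeff_C_mul, coeff_X_pow, coeff_X, coeff_C]
    norm_num
  simp [h] at this

theorem LiesOver.mem_rootSet_iff {x y : K} (h : LiesOver a x y) (u : K) :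
    u ∈ (quintic a).rootSet K ↔ ∃ i, u = formalRoots x y i := by
  rw [mem_rootSet_of_ne (quintic_ne_zero a), ← eval_map_algebraMap, h.2.2, eval_prod,
    Finset.prod_eq_zero_iff]
  simp [sub_eq_zero]

theorem LiesOver.exists_act {x y x' y' : K} (h : LiesOver a x y) (h' : LiesOver a x' y')
    (ha : (quintic a).Separable) :
    ∃ g, ∀ i, formalRoots x' y' i = formalRoots x y (act g i) :=
  h.isCycle.exists_act h'.isCycle (h.injective ha) (h'.injective ha) fun i =>
    (h.mem_rootSet_iff _).1 ((h'.mem_rootSet_iff _).2 ⟨i, rfl⟩)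

/-- For `t = 0` the quintic has the double root `1`. -/
theorem snd_ne_zero_of_separable (ha : (quintic a).Separable) : a.2 ≠ 0 := by
  intro h
  have hfac : quintic a = (X - 1) * (X - 1) * (X * (X ^ 2 - X + C a.1)) := by
    simp only [quintic, h, map_sub, map_add, map_mul, C_0, map_ofNat, map_one, map_pow]
    ring
  have := ha.squarefree (X - 1) ⟨_, hfac⟩
  rw [← C_1] at this
  exact not_isUnit_X_sub_C _ this

/-- Every `(x, y)` with nonzero coordinates lies over some point, whose second coordinate `t` is
determined by the product of the five formal roots. -/
theorem prod_X_sub_C_formalRoots {x y : K} (hx : x ≠ 0) (hy : y ≠ 0) :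
    ∃ s t : K, t * (x * y) = (1 - x) * (y - 1) * (x + y - 1) ∧
      ∏ i, (X - C (formalRoots x y i)) = quintic (s, t) := by
  have hexp : ∀ z0 z1 z2 z3 z4 : K,
      (X - C z0) * (X - C z1) * (X - C z2) * (X - C z3) * (X - C z4) =
      X ^ 5 + C (-(z0 + z1 + z2 + z3 + z4)) * X ^ 4
        + C (z0 * z1 + z0 * z2 + z0 * z3 + z0 * z4 + z1 * z2 + z1 * z3 + z1 * z4 + z2 * z3
          + z2 * z4 + z3 * z4) * X ^ 3
        + C (-(z0 * z1 * z2 + z0 * z1 * z3 + z0 * z1 * z4 + z0 * z2 * z3 + z0 * z2 * z4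
          + z0 * z3 * z4 + z1 * z2 * z3 + z1 * z2 * z4 + z1 * z3 * z4 + z2 * z3 * z4)) * X ^ 2
        + C (z0 * z1 * z2 * z3 + z0 * z1 * z2 * z4 + z0 * z1 * z3 * z4 + z0 * z2 * z3 * z4
          + z1 * z2 * z3 * z4) * X + C (-(z0 * z1 * z2 * z3 * z4)) := by
    intro z0 z1 z2 z3 z4
    simp only [map_add, map_mul, map_neg]
    ring
  rw [Fin.prod_univ_five, hexp]
  refine ⟨formalRoots x y 0 * formalRoots x y 1 * formalRoots x y 2 * formalRoots x y 3
    + formalRoots x y 0 * formalRoots x y 1 * formalRoots x y 2 * formalRoots x y 4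
    + formalRoots x y 0 * formalRoots x y 1 * formalRoots x y 3 * formalRoots x y 4
    + formalRoots x y 0 * formalRoots x y 2 * formalRoots x y 3 * formalRoots x y 4
    + formalRoots x y 1 * formalRoots x y 2 * formalRoots x y 3 * formalRoots x y 4,
    -(formalRoots x y 0 * formalRoots x y 1 * formalRoots x y 2 * formalRoots x y 3
      * formalRoots x y 4), ?_, ?_⟩
  · simp only [formalRoots, Matrix.cons_val]
    field_simp
    ring
  · refine congrArg₂ (· + ·) (congrArg₂ (· + ·) (congrArg₂ (· + ·) (congrArg₂ (· + ·)
      (congrArg₂ (· + ·) rfl ?_) ?_) ?_) rfl) rfl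
    all_goals
      refine congrArg₂ (· * ·) (congrArg C ?_) rfl
      simp only [formalRoots, Matrix.cons_val]
      field_simp
      ring

theorem map_quintic (a : M × M) :
    (quintic a).map (algebraMap M K) = quintic (algebraMap M K a.1, algebraMap M K a.2) := by
  simp only [quintic, Polynomial.map_add, Polynomial.map_mul, Polynomial.map_pow, map_X, map_C,
    Polynomial.map_sub, Polynomial.map_ofNat, Polynomial.map_one, map_sub, map_add, map_mul,
    map_pow, map_ofNat, map_one]

theorem eval_quintic (a : K × K) (u : K) :
    (quintic a).eval u = u ^ 5 + (a.2 - 3) * u ^ 4 + (a.1 - a.2 + 3) * u ^ 3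
      + (a.2 ^ 2 - a.2 - 2 * a.1 - 1) * u ^ 2 + a.1 * u + a.2 := by
  simp [quintic]

/-- Every separable specialization of the quintic has a compatible ordering of its roots: once
a root `x` is chosen, the sum `w` of `y` and `(1 - x) / y` is forced, and `y` is a root of
`Y² - w Y + (1 - x)`. -/
theorem exists_liesOver [IsAlgClosed K] (ha : (quintic a).Separable) :
    ∃ x y : K, LiesOver a x y := by
  set s := algebraMap M K a.1 with hs
  set t := algebraMap M K a.2 with ht
  have ht0 : t ≠ 0 := by
    rw [ht, Ne, map_eq_zero]
    exact snd_ne_zero_of_separable ha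
  have hdeg : (quintic (s, t)).degree ≠ 0 := by
    have h5 : (quintic (s, t)).coeff 5 = 1 := by
      simp only [quintic, coeff_add, coeff_C_mul, coeff_X_pow, coeff_X, coeff_C]
      norm_num
    intro h
    have := coeff_eq_zero_of_degree_lt (p := quintic (s, t)) (n := 5) (by rw [h]; norm_num)
    rw [this] at h5
    exact zero_ne_one h5
  obtain ⟨x, hx⟩ := IsAlgClosed.exists_root _ hdeg
  rw [IsRoot.def, eval_quintic] at hx
  simp only at hx
  have hx0 : x ≠ 0 := by
    rintro rfl
    exact ht0 (by linear_combination hx)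
  have hx1 : 1 - x ≠ 0 := by
    intro h
    have : x = 1 := by linear_combination -h
    subst this
    exact ht0 (pow_eq_zero_iff two_ne_zero |>.1 (by linear_combination hx))
  -- the value of `y + (1 - x) / y` that gives the product of the roots the value `-t`
  set w := 2 - x + t * x / (1 - x) with hw
  have hdeg2 : (X ^ 2 + C (-w) * X + C (1 - x) : K[X]).degree ≠ 0 := by
    have := degree_quadratic (a := (1 : K)) (b := -w) (c := 1 - x) one_ne_zero
    rw [C_1, one_mul] at this
    rw [this]
    norm_num
  obtain ⟨y, hy⟩ := IsAlgClosed.exists_root _ hdeg2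
  simp only [IsRoot.def, eval_add, eval_pow, eval_X, eval_mul, eval_C] at hy
  have hy0 : y ≠ 0 := by
    rintro rfl
    exact hx1 (by linear_combination hy)
  refine ⟨x, y, hx0, hy0, ?_⟩
  obtain ⟨s', t', ht', hp⟩ := prod_X_sub_C_formalRoots hx0 hy0
  have hw' : w * (1 - x) = (2 - x) * (1 - x) + t * x := by
    rw [hw]
    field_simp
  have htt : t' = t := by
    refine mul_right_cancel₀ (mul_ne_zero hx0 hy0) ?_
    rw [ht']
    linear_combination (1 - x) * hy + y * hw'
  subst htt
  have hx' : (quintic (s', t)).eval x = 0 := by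
    rw [← hp, eval_prod]
    exact Finset.prod_eq_zero (Finset.mem_univ 0) (by simp [formalRoots])
  rw [eval_quintic] at hx'
  simp only at hx'
  -- `s` enters the equation for the root `x` linearly, with coefficient `x (1 - x)²`
  have hss : s' = s := by
    refine sub_eq_zero.1 ((mul_eq_zero.1 ?_).resolve_right (mul_ne_zero hx0 (pow_ne_zero 2 hx1)))
    linear_combination hx' - hx
  rw [map_quintic, hp, hss]

end LiesOver

/-! ### Independence of the choice of orderings -/

section WellDefined

variable {M : Type*} [Field M] {K : Type*} [Field K] [Algebra M K] {a a' : M × M}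
  {x y x' y' : K}

theorem isDT₁_iff (h : LiesOver a x y) (h' : LiesOver a' x' y') (ha : (quintic a).Separable)
    (ha' : (quintic a').Separable) (μ : Multiset ℕ) :
    IsDT₁ K a a' μ ↔ IsResolventType M (formalRoots x y) (formalRoots x' y') μ := by
  constructor
  · rintro ⟨u, v, u', v', hu, hu', hμ⟩
    obtain ⟨g, hg⟩ := h.exists_act hu ha
    obtain ⟨g', hg'⟩ := h'.exists_act hu' ha'
    rwa [funext hg, funext hg', isResolventType_comp_act] at hμ
  · exact fun hμ => ⟨x, y, x', y', h, h', hμ⟩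

theorem isDT₂_iff (h : LiesOver a x y) (h' : LiesOver a' x' y') (ha : (quintic a).Separable)
    (ha' : (quintic a').Separable) (μ : Multiset ℕ) :
    IsDT₂ K a a' μ ↔
      IsResolventType M (fun i => moebius (formalRoots x y (2 * i))) (formalRoots x' y') μ := by
  constructor
  · rintro ⟨u, v, u', v', hu, hu', hμ⟩
    obtain ⟨g, hg⟩ := h.exists_act hu ha
    obtain ⟨g', hg'⟩ := h'.exists_act hu' ha'
    rw [formalRoots_rho hu.1 hu.2.1 (hu.injective ha), funext hg, funext hg'] at hμ
    simp only [← two_mul_act_twist] at hμ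
    exact (isResolventType_comp_act (fun i => moebius (formalRoots x y (2 * i))) _
      (twist g) g' μ).1 hμ
  · intro hμ
    refine ⟨x, y, x', y', h, h', ?_⟩
    rwa [formalRoots_rho h.1 h.2.1 (h.injective ha)]

end WellDefined

/-! ### The Galois group inside `D₅` -/

section Galois

variable {M : Type*} [Field M] {E : Type*} [Field E] [Algebra M E] {a : M × M} {x y : E}

theorem LiesOver.map (h : LiesOver a x y) (g : E ≃ₐ[M] E) : LiesOver a (g x) (g y) := by
  refine ⟨by simpa using h.1, by simpa using h.2.1, ?_⟩
  have h1 := congrArg (Polynomial.map (g : E →+* E)) h.2.2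
  rw [Polynomial.map_map, Polynomial.map_prod] at h1
  have h2 : (g : E →+* E).comp (algebraMap M E) = algebraMap M E := by
    ext m
    simp
  rw [h2] at h1
  rw [h1]
  refine Finset.prod_congr rfl fun i _ => ?_
  rw [Polynomial.map_sub, map_X, map_C]
  exact congrArg (fun u => X - C u) (map_formalRoots (g : E →+* E) x y i).symm

/-- The Galois group permutes the roots of the quintic through `D₅`. -/
theorem LiesOver.exists_hom (h : LiesOver a x y) (ha : (quintic a).Separable) :
    ∃ φ : (E ≃ₐ[M] E) →* DihedralGroup 5,
      ∀ g i, g (formalRoots x y i) = formalRoots x y (act (φ g) i) := by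
  have key : ∀ g : E ≃ₐ[M] E, ∃ d, ∀ i, g (formalRoots x y i) = formalRoots x y (act d i) := by
    intro g
    obtain ⟨d, hd⟩ := h.exists_act (h.map g) ha
    exact ⟨d, fun i => by rw [← hd]; exact (map_formalRoots (g : E →+* E) x y i).symm⟩
  choose φ hφ using key
  refine ⟨MonoidHom.mk' φ fun g k => act_faithful _ _ fun i => h.injective ha ?_, hφ⟩
  rw [← hφ, act_mul, ← hφ, ← hφ]
  rfl

variable {φ : (E ≃ₐ[M] E) →* DihedralGroup 5}

theorem LiesOver.mem_ker_iff (h : LiesOver a x y) (ha : (quintic a).Separable)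
    (hφ : ∀ g i, g (formalRoots x y i) = formalRoots x y (act (φ g) i)) (g : E ≃ₐ[M] E) :
    g ∈ φ.ker ↔ ∀ u ∈ (quintic a).rootSet E, g u = u := by
  rw [MonoidHom.mem_ker]
  constructor
  · intro hg u hu
    obtain ⟨i, rfl⟩ := (h.mem_rootSet_iff u).1 hu
    rw [hφ, hg, act_one]
  · intro hg
    refine act_faithful _ _ fun i => h.injective ha ?_
    rw [← hφ, act_one, hg _ ((h.mem_rootSet_iff _).2 ⟨i, rfl⟩)]

theorem LiesOver.fixingSubgroup_splittingField (h : LiesOver a x y) (ha : (quintic a).Separable)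
    (hφ : ∀ g i, g (formalRoots x y i) = formalRoots x y (act (φ g) i)) :
    (splittingField E a).fixingSubgroup = φ.ker := by
  ext g
  rw [h.mem_ker_iff ha hφ, ← Subgroup.zpowers_le, ← IntermediateField.le_iff_le, splittingField,
    IntermediateField.adjoin_le_iff]
  refine forall₂_congr fun u _ => ?_
  simp only [SetLike.mem_coe, IntermediateField.mem_fixedField_iff]
  constructor
  · exact fun hu => hu g (Subgroup.mem_zpowers g)
  · intro hu k hk
    have : Subgroup.zpowers g ≤ MulAction.stabilizer (E ≃ₐ[M] E) u := by
      rw [Subgroup.zpowers_le]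
      exact hu
    exact this hk

theorem LiesOver.splits (h : LiesOver a x y) : ((quintic a).map (algebraMap M E)).Splits := by
  rw [h.2.2]
  exact Splits.prod fun i _ => Splits.X_sub_C _

/-- The Galois group of the quintic is the image of the Galois group of any normal extension
in which it splits. -/
theorem LiesOver.nonempty_gal_equiv [Normal M E] (h : LiesOver a x y)
    (ha : (quintic a).Separable)
    (hφ : ∀ g i, g (formalRoots x y i) = formalRoots x y (act (φ g) i)) :
    Nonempty ((quintic a).Gal ≃* φ.range) := by
  have : Fact ((quintic a).map (algebraMap M E)).Splits := ⟨h.splits⟩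
  have hker : (Gal.restrict (quintic a) E).ker = φ.ker := by
    ext g
    rw [h.mem_ker_iff ha hφ, MonoidHom.mem_ker]
    constructor
    · intro hg u hu
      rw [← Gal.restrict_smul g (⟨u, hu⟩ : (quintic a).rootSet E), hg, one_smul]
    · intro hg
      refine Gal.galActionHom_injective (quintic a) E ?_
      rw [map_one]
      ext u
      rw [Gal.galActionHom_restrict, hg _ u.2]
      rfl
  exact ⟨(QuotientGroup.quotientKerEquivOfSurjective _
    (Gal.restrict_surjective (quintic a) E)).symm.trans
    ((QuotientGroup.quotientMulEquivOfEq hker).trans (QuotientGroup.quotientKerEquivRange φ))⟩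

end Galois

/-! ### The compositum of the splitting fields -/

section Compositum

variable {M : Type*} [Field M] {K : Type*} [Field K] [Algebra M K] {a a' : M × M}

/-- The splitting field of the product of the two quintics inside `K`. -/
def compositum (K : Type*) [Field K] [Algebra M K] (a a' : M × M) : IntermediateField M K :=
  IntermediateField.adjoin M ((quintic a * quintic a').rootSet K)

theorem isGalois_compositum (ha : (quintic a).Separable) (ha' : (quintic a').Separable)
    [IsSplittingField M (compositum K a a') (quintic a * quintic a')] :
    IsGalois M (compositum K a a') := by
  have hsep : Algebra.IsSeparable M (compositum K a a') := by
    refine (IntermediateField.isSeparable_adjoin_iff_isSeparable _ _).2 fun u hu => ?_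
    have h0 := (mem_rootSet.1 hu).2
    rw [map_mul, mul_eq_zero] at h0
    rcases h0 with h0 | h0
    · exact ha.of_dvd (minpoly.dvd M u h0)
    · exact ha'.of_dvd (minpoly.dvd M u h0)
  have := Normal.of_isSplittingField (E := compositum K a a') (quintic a * quintic a')
  exact IsGalois.mk

theorem LiesOver.exists_lift {E : IntermediateField M K} {x y : K} (h : LiesOver a x y)
    (hE : (quintic a).rootSet K ⊆ E) :
    ∃ u v : E, LiesOver a u v ∧
      ∀ i, formalRoots x y i = algebraMap E K (formalRoots u v i) := by
  have hx : x ∈ E := hE ((h.mem_rootSet_iff _).2 ⟨0, rfl⟩)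
  have hy : y ∈ E := hE ((h.mem_rootSet_iff _).2 ⟨1, rfl⟩)
  have hf : ∀ i, formalRoots x y i = algebraMap E K (formalRoots (⟨x, hx⟩ : E) ⟨y, hy⟩ i) :=
    fun i => map_formalRoots (algebraMap E K) ⟨x, hx⟩ ⟨y, hy⟩ i
  refine ⟨⟨x, hx⟩, ⟨y, hy⟩, ⟨fun e => h.1 (congrArg Subtype.val e),
    fun e => h.2.1 (congrArg Subtype.val e), ?_⟩, hf⟩
  apply map_injective _ (algebraMap E K).injective
  rw [Polynomial.map_map, ← IsScalarTower.algebraMap_eq, h.2.2, Polynomial.map_prod]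
  simp [hf]

theorem map_splittingField {E : IntermediateField M K} {x y : K} {u v : E} (h : LiesOver a x y)
    (huv : LiesOver a u v) (hf : ∀ i, formalRoots x y i = algebraMap E K (formalRoots u v i)) :
    (splittingField E a).map E.val = splittingField K a := by
  rw [splittingField, IntermediateField.adjoin_map, splittingField]
  congr 1
  ext w
  rw [h.mem_rootSet_iff, Set.mem_image]
  constructor
  · rintro ⟨s, hs, rfl⟩
    obtain ⟨i, rfl⟩ := (huv.mem_rootSet_iff s).1 hs
    exact ⟨i, (hf i).symm⟩
  · rintro ⟨i, rfl⟩
    exact ⟨_, (huv.mem_rootSet_iff _).2 ⟨i, rfl⟩, (hf i).symm⟩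

end Compositum

/-! ### The groups in the table -/

section Iso

variable {G H N : Type*} [Group G] [Group H] [Group N]

theorem Iso.symm (h : Iso G H) : Iso H G := h.map MulEquiv.symm

theorem Iso.trans (h : Iso G H) (h' : Iso H N) : Iso G N :=
  h.elim fun e => h'.map e.trans

theorem Iso.prod {G' H' : Type*} [Group G'] [Group H'] (h : Iso G H) (h' : Iso G' H') :
    Iso (G × G') (H × H') :=
  h.elim fun e => h'.map e.prodCongr

theorem Iso.card_eq (h : Iso G H) : Nat.card G = Nat.card H :=
  h.elim fun e => Nat.card_congr e.toEquiv

theorem iso_of_range_eq {f : G →* N} {f' : H →* N} (hf : Function.Injective f)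
    (hf' : Function.Injective f') (h : f.range = f'.range) : Iso G H :=
  ⟨(MonoidHom.ofInjective hf).trans
    ((MulEquiv.subgroupCongr h).trans (MonoidHom.ofInjective hf').symm)⟩

theorem iso_dihedral_ten : Iso (DihedralGroup 5 × Cyc 2) (DihedralGroup 10) := by
  let f : DihedralGroup 10 → DihedralGroup 5 × Cyc 2 := fun x => match x with
    | .r i => (r (i.val : ZMod 5), Multiplicative.ofAdd (i.val : ZMod 2))
    | .sr i => (sr (i.val : ZMod 5), Multiplicative.ofAdd (i.val : ZMod 2))
  have hm : ∀ x y, f (x * y) = f x * f y := by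
    decide +kernel
  have hb : Function.Bijective f := by
    decide +kernel
  exact Iso.symm ⟨MulEquiv.ofBijective (MonoidHom.mk' f hm) hb⟩

theorem iso_cyc_ten : Iso (Cyc 5 × Cyc 2) (Cyc 10) :=
  ⟨(MulEquiv.prodMultiplicative (G := ZMod 5) (H := ZMod 2)).symm.trans
    (AddEquiv.toMultiplicative
      (ZMod.chineseRemainder (m := 5) (n := 2) (by norm_num)).symm.toAddEquiv)⟩

theorem inversion_cases (g : inversionGroup) :
    g = 1 ∨ g = ⟨MulEquiv.inv (Cyc 5 × Cyc 5), Subgroup.mem_zpowers _⟩ := by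
  obtain ⟨g, k, rfl⟩ := g
  have h2 : (MulEquiv.inv (Cyc 5 × Cyc 5) : MulAut (Cyc 5 × Cyc 5)) ^ (2 : ℤ) = 1 := by
    rw [zpow_two]
    exact MulEquiv.ext fun x => inv_inv x
  rcases Int.even_or_odd' k with ⟨m, rfl | rfl⟩
  · left
    ext1
    simp only [zpow_mul, h2, one_zpow]
    rfl
  · right
    ext1
    simp only [zpow_add, zpow_mul, h2, one_zpow, one_mul, zpow_one]

theorem inversion_ne_one :
    (⟨MulEquiv.inv (Cyc 5 × Cyc 5), Subgroup.mem_zpowers _⟩ : inversionGroup) ≠ 1 := by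
  intro h
  have h1 : (MulEquiv.inv (Cyc 5 × Cyc 5) : MulAut (Cyc 5 × Cyc 5)) = 1 :=
    congrArg Subtype.val h
  have h2 := DFunLike.congr_fun h1 (Multiplicative.ofAdd (1 : ZMod 5), 1)
  revert h2
  decide +kernel

end Iso

/-! ### Subgroups of `D₅` -/

section Subgroups

theorem subgroup_cases (S : Subgroup (DihedralGroup 5)) :
    (∀ x, x ∈ S ↔ x = 1) ∨ (∃ b, ∀ x, x ∈ S ↔ x ∈ reflPair b) ∨ (∀ x, x ∈ S ↔ x ∈ rotations) ∨
      ∀ x, x ∈ S := by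
  have hrot : ∀ x, x ∈ rotations ↔ ∃ i, r i = x := fun x => by simp [rotations]
  have hr1 : ∀ j : ZMod 5, (r j : DihedralGroup 5) = 1 ↔ j = 0 := by decide +kernel
  have hs1 : ∀ j : ZMod 5, (sr j : DihedralGroup 5) ≠ 1 := by decide +kernel
  have hrefl : ∀ b x, x ∈ reflPair b ↔ x = 1 ∨ x = sr b := fun b x => by simp [reflPair]
  by_cases h1 : ∃ i, i ≠ 0 ∧ r i ∈ S
  · obtain ⟨i, hi, hiS⟩ := h1
    have key : ∀ i : ZMod 5, i ≠ 0 → ∀ j : ZMod 5, ∃ k : Fin 5, r i ^ (k : ℕ) = r j := by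
      decide +kernel
    have hall : ∀ j, r j ∈ S := fun j => by
      obtain ⟨k, hk⟩ := key i hi j
      exact hk ▸ S.pow_mem hiS k
    by_cases h2 : ∃ b, sr b ∈ S
    · obtain ⟨b, hb⟩ := h2
      refine .inr (.inr (.inr ?_))
      rintro (j | j)
      · exact hall j
      · have := S.mul_mem hb (hall (j - b))
        rwa [sr_mul_r, add_sub_cancel] at this
    · refine .inr (.inr (.inl ?_))
      rintro (j | j)
      · simpa [hrot] using hall j
      · simpa [hrot] using fun h => h2 ⟨j, h⟩
  · push Not at h1
    have hr : ∀ j, r j ∈ S ↔ j = 0 := fun j =>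
      ⟨fun h => by_contra fun h0 => h1 j h0 h, by rintro rfl; exact S.one_mem⟩
    by_cases h2 : ∃ b, sr b ∈ S
    · obtain ⟨b, hb⟩ := h2
      refine .inr (.inl ⟨b, ?_⟩)
      rintro (j | j)
      · simp [hrefl, hr, hr1]
      · simp only [hrefl, hs1, sr.injEq, false_or]
        refine ⟨fun h => ?_, by rintro rfl; exact hb⟩
        have := S.mul_mem hb h
        rw [sr_mul_sr, hr] at this
        exact sub_eq_zero.1 this
    · left
      rintro (j | j)
      · simp [hr, hr1]
      · simpa [hs1] using fun h => h2 ⟨j, h⟩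

theorem card_eq_of_mem_iff {S : Subgroup (DihedralGroup 5)} {T : Finset (DihedralGroup 5)}
    (h : ∀ x, x ∈ S ↔ x ∈ T) : Nat.card S = T.card := by
  rw [Nat.card_congr (Equiv.subtypeEquivRight h), Nat.card_eq_fintype_card, Fintype.card_coe]

theorem card_reflPair : ∀ b, (reflPair b).card = 2 := by
  decide +kernel

theorem card_rotations : rotations.card = 5 := by
  decide +kernel

theorem iso_cyc {G : Type*} [Group G] {p : ℕ} [Fact p.Prime] (h : Nat.card G = p) :
    Iso G (Cyc p) :=
  ⟨mulEquivOfPrimeCardEq (p := p) h (by simp)⟩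

end Subgroups

/-! ### Subdirect products in `D₅ × D₅` -/

section Subdirect

variable {Γ : Type*} [Group Γ] {φ φ' : Γ →* DihedralGroup 5}

theorem twistFst_pairSet (φ φ' : Γ →* DihedralGroup 5) :
    pairSet ((MonoidHom.mk' twist twist_mul).comp φ) φ' = twistFst (pairSet φ φ') := by
  ext ⟨u, v⟩
  simp only [mem_pairSet, twistFst, Finset.mem_image, Prod.mk.injEq, Prod.exists]
  constructor
  · rintro ⟨g, rfl, rfl⟩
    exact ⟨φ g, φ' g, ⟨g, rfl, rfl⟩, rfl, rfl⟩
  · rintro ⟨_, _, ⟨g, rfl, rfl⟩, rfl, rfl⟩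
    exact ⟨g, rfl, rfl⟩

theorem pairSet_eq_image {ι : Type*} [Fintype ι] {f : ι → DihedralGroup 5 × DihedralGroup 5}
    (h1 : ∀ g, ∃ i, f i = (φ g, φ' g)) (h2 : ∀ i, ∃ g, f i = (φ g, φ' g)) :
    pairSet φ φ' = Finset.univ.image f := by
  ext u
  simp only [mem_pairSet, Finset.mem_image, Finset.mem_univ, true_and]
  constructor
  · rintro ⟨g, hg, hg'⟩
    obtain ⟨i, hi⟩ := h1 g
    exact ⟨i, by rw [hi, hg, hg']⟩
  · rintro ⟨i, rfl⟩
    obtain ⟨g, hg⟩ := h2 i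
    exact ⟨g, by rw [hg], by rw [hg]⟩

theorem prod_injective (hinj : φ.ker ⊓ φ'.ker = ⊥) : Function.Injective (φ.prod φ') := by
  rw [← MonoidHom.ker_eq_bot_iff, MonoidHom.ker_prod, hinj]

/-! ### Full products -/

section Full

variable (hfull : φ'.range ≤ φ.ker.map φ')

include hfull

theorem exists_of_full {u v : DihedralGroup 5} (hu : u ∈ φ.range) (hv : v ∈ φ'.range) :
    ∃ g, φ g = u ∧ φ' g = v := by
  obtain ⟨g, rfl⟩ := hu
  obtain ⟨n, hn, hn'⟩ := hfull (φ'.range.mul_mem hv (φ'.range.inv_mem ⟨g, rfl⟩))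
  refine ⟨n * g, ?_, ?_⟩
  · rw [map_mul, MonoidHom.mem_ker.1 hn, one_mul]
  · rw [map_mul, hn', inv_mul_cancel_right]

theorem pairSet_of_full {T T' : Finset (DihedralGroup 5)} (hT : ∀ x, x ∈ φ.range ↔ x ∈ T)
    (hT' : ∀ x, x ∈ φ'.range ↔ x ∈ T') : pairSet φ φ' = T ×ˢ T' := by
  ext ⟨u, v⟩
  rw [mem_pairSet, Finset.mem_product, ← hT, ← hT']
  constructor
  · rintro ⟨g, hg, hg'⟩
    exact ⟨⟨g, hg⟩, ⟨g, hg'⟩⟩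
  · rintro ⟨hu, hv⟩
    exact exists_of_full hfull hu hv

theorem iso_of_full (hinj : φ.ker ⊓ φ'.ker = ⊥) : Iso Γ (φ.range × φ'.range) := by
  refine ⟨MulEquiv.ofBijective (φ.rangeRestrict.prod φ'.rangeRestrict) ⟨?_, ?_⟩⟩
  · intro g h hgh
    refine prod_injective hinj (Prod.ext ?_ ?_)
    · exact congrArg Subtype.val (congrArg Prod.fst hgh)
    · exact congrArg Subtype.val (congrArg Prod.snd hgh)
  · rintro ⟨⟨u, hu⟩, ⟨v, hv⟩⟩
    obtain ⟨g, rfl, rfl⟩ := exists_of_full hfull hu hv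
    exact ⟨g, rfl⟩

theorem sup_ker_of_full : φ.ker ⊔ φ'.ker = ⊤ := by
  refine (eq_top_iff).2 fun g _ => ?_
  obtain ⟨n, hn, hn'⟩ := hfull ⟨g, rfl⟩
  have : n⁻¹ * g ∈ φ'.ker := by
    rw [MonoidHom.mem_ker, map_mul, map_inv, hn', inv_mul_cancel]
  rw [← mul_inv_cancel_left n g]
  exact Subgroup.mul_mem_sup hn this

theorem not_ker_le_of_full (hlt : 1 < Nat.card φ'.range) : ¬ φ.ker ≤ φ'.ker := by
  intro h
  have := sup_ker_of_full hfull
  rw [sup_eq_right.2 h, ← Subgroup.index_eq_one, Subgroup.index_ker] at this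
  omega

end Full

/-! ### Graphs of homomorphisms -/

section Graph

variable (hker : φ.ker ≤ φ'.ker)

include hker

theorem apply_eq_of_ker_le {g h : Γ} (e : φ g = φ h) : φ' g = φ' h := by
  have : g * h⁻¹ ∈ φ'.ker := hker (by rw [MonoidHom.mem_ker, map_mul, map_inv, e, mul_inv_cancel])
  rwa [MonoidHom.mem_ker, map_mul, map_inv, mul_inv_eq_one] at this

theorem injective_of_ker_le (hinj : φ.ker ⊓ φ'.ker = ⊥) : Function.Injective φ := by
  rw [← MonoidHom.ker_eq_bot_iff, ← inf_eq_left.2 hker, hinj]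

theorem iso_of_ker_le (hinj : φ.ker ⊓ φ'.ker = ⊥) : Iso Γ φ.range :=
  ⟨MonoidHom.ofInjective (injective_of_ker_le hker hinj)⟩

theorem ker_eq_of_card_eq (hinj : φ.ker ⊓ φ'.ker = ⊥)
    (hcard : Nat.card φ.range = Nat.card φ'.range) : φ.ker = φ'.ker := by
  have hφ := injective_of_ker_le hker hinj
  have : Finite Γ := Finite.of_injective φ hφ
  have h0 : φ.ker = ⊥ := (MonoidHom.ker_eq_bot_iff φ).2 hφ
  have h1 := φ.ker.card_mul_index
  have h2 := φ'.ker.card_mul_index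
  rw [Subgroup.index_ker] at h1 h2
  rw [← h1, hcard] at h2
  have h3 := Nat.eq_of_mul_eq_mul_right Nat.card_pos h2
  rw [h0, Subgroup.card_bot, Subgroup.card_eq_one] at h3
  rw [h0, h3]

end Graph

theorem card_range_eq_one (h : ∀ g, φ' g = 1) : Nat.card φ'.range = 1 := by
  have : φ' = 1 := MonoidHom.ext h
  rw [this, MonoidHom.range_one, Subgroup.card_bot]

/-- A normal subgroup of a group of prime order is trivial or everything, so by Goursat's lemma a
subdirect product with such a factor is a full product or a graph. -/
theorem full_or_ker_le (hp : (Nat.card φ'.range).Prime) :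
    φ'.range ≤ φ.ker.map φ' ∨ φ.ker ≤ φ'.ker := by
  have := Fact.mk hp
  rcases (φ.ker.map φ'.rangeRestrict).eq_bot_or_eq_top_of_prime_card with h | h
  · right
    rwa [Subgroup.map_eq_bot_iff, MonoidHom.ker_rangeRestrict] at h
  · left
    rintro _ ⟨g, rfl⟩
    have : φ'.rangeRestrict g ∈ φ.ker.map φ'.rangeRestrict := h ▸ Subgroup.mem_top _
    obtain ⟨n, hn, hn'⟩ := this
    exact ⟨n, hn, congrArg Subtype.val hn'⟩

theorem mem_rotations {x : DihedralGroup 5} : x ∈ rotations ↔ ∃ i, x = r i := by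
  simp [rotations, eq_comm]

theorem mem_reflPair {x : DihedralGroup 5} {b : ZMod 5} : x ∈ reflPair b ↔ x = 1 ∨ x = sr b := by
  simp [reflPair]

/-! ### Homomorphisms between subgroups of `D₅` -/

section Cases

variable (hker : φ.ker ≤ φ'.ker) (hlt : 1 < Nat.card φ'.range)

theorem r_pow_val : ∀ k i : ZMod 5, (r k : DihedralGroup 5) ^ i.val = r (k * i) := by
  decide +kernel

theorem r_one_pow_val (i : ZMod 5) : (r 1 : DihedralGroup 5) ^ i.val = r i := by
  rw [r_pow_val, one_mul]

theorem pow_five_r : ∀ i : ZMod 5, (r i : DihedralGroup 5) ^ 5 = 1 := by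
  decide +kernel

theorem sr_ne_one : ∀ i : ZMod 5, (sr i : DihedralGroup 5) ≠ 1 := by
  decide +kernel

theorem sr_pow_five : ∀ i : ZMod 5, (sr i : DihedralGroup 5) ^ 5 = sr i := by
  decide +kernel

theorem exists_r_of_pow_five : ∀ x : DihedralGroup 5, x ^ 5 = 1 → ∃ i, x = r i := by
  decide +kernel

theorem exists_sr_of_sq : ∀ x : DihedralGroup 5, x * x = 1 → x ≠ 1 → ∃ b, x = sr b := by
  decide +kernel

include hker

theorem pow_five_of_rotation {g : Γ} {i : ZMod 5} (hg : φ g = r i) : φ' g ^ 5 = 1 := by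
  rw [← map_pow]
  refine (apply_eq_of_ker_le hker (h := 1) ?_).trans (map_one _)
  rw [map_pow, hg, pow_five_r, map_one]

theorem sq_of_reflection {g : Γ} {i : ZMod 5} (hg : φ g = sr i) : φ' g * φ' g = 1 := by
  rw [← map_mul]
  refine (apply_eq_of_ker_le hker (h := 1) ?_).trans (map_one _)
  rw [map_mul, hg, sr_mul_self, map_one]

theorem apply_of_rotation {γ g : Γ} {k i : ZMod 5} (hγ : φ γ = r 1) (hγ' : φ' γ = r k)
    (hg : φ g = r i) : φ' g = r (k * i) := by
  rw [← r_pow_val, ← hγ', ← map_pow]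
  refine apply_eq_of_ker_le hker ?_
  rw [hg, map_pow, hγ, r_one_pow_val]

theorem eq_one_of_rotation_of_reflPair {c : ZMod 5} (h' : ∀ x, x ∈ φ'.range ↔ x ∈ reflPair c)
    {g : Γ} {i : ZMod 5} (hg : φ g = r i) : φ' g = 1 := by
  rcases mem_reflPair.1 ((h' _).1 ⟨g, rfl⟩) with h | h
  · exact h
  · have := pow_five_of_rotation hker hg
    rw [h, sr_pow_five] at this
    exact absurd this (sr_ne_one c)

theorem pairSet_reflPair {b c : ZMod 5} (h : ∀ x, x ∈ φ.range ↔ x ∈ reflPair b)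
    (h' : ∀ x, x ∈ φ'.range ↔ x ∈ reflPair c) : pairSet φ φ' = {(1, 1), (sr b, sr c)} := by
  obtain ⟨γ, hγ⟩ := (h' (sr c)).2 (mem_reflPair.2 (.inr rfl))
  have h1 : ∀ g, φ g = 1 → φ' g = 1 := fun g hg => hker hg
  have hγb : φ γ = sr b := by
    rcases mem_reflPair.1 ((h _).1 ⟨γ, rfl⟩) with e | e
    · have := h1 γ e
      rw [hγ] at this
      exact absurd this (sr_ne_one c)
    · exact e
  ext ⟨u, v⟩
  simp only [mem_pairSet, Finset.mem_insert, Finset.mem_singleton, Prod.mk.injEq]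
  constructor
  · rintro ⟨g, rfl, rfl⟩
    rcases mem_reflPair.1 ((h _).1 ⟨g, rfl⟩) with e | e
    · exact .inl ⟨e, h1 g e⟩
    · exact .inr ⟨e, (apply_eq_of_ker_le hker (e.trans hγb.symm)).trans hγ⟩
  · rintro (⟨rfl, rfl⟩ | ⟨rfl, rfl⟩)
    · exact ⟨1, map_one _, map_one _⟩
    · exact ⟨γ, hγb, hγ⟩

include hlt

/-- There is no nontrivial homomorphism from `C₅` to `C₂`. -/
theorem not_rotations_reflPair {c : ZMod 5} (h : ∀ x, x ∈ φ.range ↔ x ∈ rotations)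
    (h' : ∀ x, x ∈ φ'.range ↔ x ∈ reflPair c) : False := by
  refine hlt.ne' (card_range_eq_one fun g => ?_)
  obtain ⟨i, hi⟩ := mem_rotations.1 ((h _).1 ⟨g, rfl⟩)
  exact eq_one_of_rotation_of_reflPair hker h' hi

theorem pairSet_rotations (h : ∀ x, x ∈ φ.range ↔ x ∈ rotations)
    (h' : ∀ x, x ∈ φ'.range ↔ x ∈ rotations) :
    ∃ k : ZMod 5, k ≠ 0 ∧ pairSet φ φ' = Finset.univ.image fun i : ZMod 5 => (r i, r (k * i)) := by
  obtain ⟨γ, hγ⟩ := (h (r 1)).2 (mem_rotations.2 ⟨1, rfl⟩)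
  obtain ⟨k, hk⟩ := mem_rotations.1 ((h' _).1 ⟨γ, rfl⟩)
  refine ⟨k, ?_, pairSet_eq_image ?_ ?_⟩
  · rintro rfl
    refine hlt.ne' (card_range_eq_one fun g => ?_)
    obtain ⟨i, hi⟩ := mem_rotations.1 ((h _).1 ⟨g, rfl⟩)
    rw [apply_of_rotation hker hγ hk hi, zero_mul, one_def]
  · intro g
    obtain ⟨i, hi⟩ := mem_rotations.1 ((h _).1 ⟨g, rfl⟩)
    exact ⟨i, by rw [hi, apply_of_rotation hker hγ hk hi]⟩
  · intro i
    obtain ⟨g, hg⟩ := (h (r i)).2 (mem_rotations.2 ⟨i, rfl⟩)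
    exact ⟨g, by rw [hg, apply_of_rotation hker hγ hk hg]⟩

omit hlt in
theorem pairSet_univ_reflPair {c : ZMod 5} (h : ∀ x, x ∈ φ.range)
    (h' : ∀ x, x ∈ φ'.range ↔ x ∈ reflPair c) : pairSet φ φ' = graphSign c := by
  have h1 : ∀ {g i}, φ g = r i → φ' g = 1 := eq_one_of_rotation_of_reflPair hker h'
  have h2 : ∀ {g i}, φ g = sr i → φ' g = sr c := by
    obtain ⟨γ, hγ⟩ := (h' (sr c)).2 (mem_reflPair.2 (.inr rfl))
    intro g i hg
    rcases e : φ γ with j | j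
    · have := h1 e
      rw [hγ] at this
      exact absurd this (sr_ne_one c)
    · have : φ' (g * γ⁻¹) = 1 := h1 (i := j - i) (by rw [map_mul, map_inv, hg, e]; rfl)
      rw [map_mul, map_inv, mul_inv_eq_one] at this
      exact this.trans hγ
  ext ⟨u, v⟩
  simp only [mem_pairSet, graphSign, Finset.mem_union, Finset.mem_image, Finset.mem_univ,
    true_and, Prod.mk.injEq]
  constructor
  · rintro ⟨g, rfl, rfl⟩
    rcases e : φ g with j | j
    · exact .inl ⟨j, rfl, (h1 e).symm⟩
    · exact .inr ⟨j, rfl, (h2 e).symm⟩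
  · rintro (⟨j, rfl, rfl⟩ | ⟨j, rfl, rfl⟩)
    · obtain ⟨g, hg⟩ := h (r j)
      exact ⟨g, hg, h1 hg⟩
    · obtain ⟨g, hg⟩ := h (sr j)
      exact ⟨g, hg, h2 hg⟩

/-- There is no nontrivial homomorphism from `D₅` to `C₅`, as `D₅` is generated by reflections. -/
theorem not_univ_rotations (h : ∀ x, x ∈ φ.range)
    (h' : ∀ x, x ∈ φ'.range ↔ x ∈ rotations) : False := by
  have h2 : ∀ {g i}, φ g = sr i → φ' g = 1 := by
    intro g i hg
    obtain ⟨k, hk⟩ := mem_rotations.1 ((h' _).1 ⟨g, rfl⟩)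
    by_contra hne
    obtain ⟨b, hb⟩ := exists_sr_of_sq _ (sq_of_reflection hker hg) hne
    rw [hk] at hb
    exact nomatch hb
  refine hlt.ne' (card_range_eq_one fun g => ?_)
  rcases e : φ g with j | j
  · obtain ⟨γ, hγ⟩ := h (sr 0)
    have := h2 (g := γ * g) (i := j) (by rw [map_mul, hγ, e, sr_mul_r, zero_add])
    rwa [map_mul, h2 hγ, one_mul] at this
  · exact h2 e

omit hlt in
/-- The automorphisms of `D₅` are `r i ↦ r (k * i)`, `s r i ↦ s r (b + k * i)` with `k ≠ 0`. -/
theorem pairSet_univ (hinj : φ.ker ⊓ φ'.ker = ⊥) (h : ∀ x, x ∈ φ.range)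
    (h' : ∀ x, x ∈ φ'.range) : ∃ k b : ZMod 5, k ≠ 0 ∧ pairSet φ φ' = graphAut k b := by
  have hk' : φ.ker = φ'.ker := by
    refine ker_eq_of_card_eq hker hinj ?_
    rw [(Subgroup.eq_top_iff' _).2 h, (Subgroup.eq_top_iff' _).2 h']
  obtain ⟨γ, hγ⟩ := h (r 1)
  obtain ⟨δ, hδ⟩ := h (sr 0)
  have hne : ∀ g, φ g ≠ 1 → φ' g ≠ 1 := fun g hg hg' => hg (hk'.ge hg')
  obtain ⟨k, hk⟩ := exists_r_of_pow_five _ (pow_five_of_rotation hker hγ)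
  obtain ⟨b, hb⟩ := exists_sr_of_sq _ (sq_of_reflection hker hδ)
    (hne δ (by rw [hδ]; decide +kernel))
  have h1 : ∀ {g i}, φ g = r i → φ' g = r (k * i) := apply_of_rotation hker hγ hk
  have h2 : ∀ {g i}, φ g = sr i → φ' g = sr (b + k * i) := by
    intro g i hg
    have := h1 (g := δ⁻¹ * g) (i := i) (by
      rw [map_mul, map_inv, hg, hδ]
      change sr 0 * sr i = _
      rw [sr_mul_sr, sub_zero])
    rw [map_mul, map_inv, inv_mul_eq_iff_eq_mul, hb, sr_mul_r] at this
    exact this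
  refine ⟨k, b, ?_, ?_⟩
  · rintro rfl
    refine hne γ (by rw [hγ]; decide +kernel) ?_
    rw [hk, one_def]
  ext ⟨u, v⟩
  simp only [mem_pairSet, graphAut, Finset.mem_union, Finset.mem_image, Finset.mem_univ,
    true_and, Prod.mk.injEq]
  constructor
  · rintro ⟨g, rfl, rfl⟩
    rcases e : φ g with j | j
    · exact .inl ⟨j, rfl, (h1 e).symm⟩
    · exact .inr ⟨j, rfl, (h2 e).symm⟩
  · rintro (⟨j, rfl, rfl⟩ | ⟨j, rfl, rfl⟩)
    · obtain ⟨g, hg⟩ := h (r j)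
      exact ⟨g, hg, h1 hg⟩
    · obtain ⟨g, hg⟩ := h (sr j)
      exact ⟨g, hg, h2 hg⟩

end Cases

/-! ### The fibre product over `C₂` -/

section Half

variable (h' : ∀ x, x ∈ φ'.range)
  (hN : ∀ x, x ∈ φ.ker.map φ' ↔ x ∈ rotations)

include hN h'

/-- If the elements `(1, h)` of a subdirect product in `D₅ × D₅` are those with `h` a rotation, then
its elements are the pairs of equal sign: the fifth power of a pair `(r i, s r j)` would be
`(1, s r j)`. -/
theorem pairSet_of_rotations (h : ∀ x, x ∈ φ.range) : pairSet φ φ' = sameSign := by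
  have hrot : ∀ g k, ∃ g₁, φ g₁ = φ g ∧ φ' g₁ = r k * φ' g := by
    intro g k
    obtain ⟨n, hn, hn'⟩ := (hN (r k)).2 (mem_rotations.2 ⟨k, rfl⟩)
    exact ⟨n * g, by rw [map_mul, MonoidHom.mem_ker.1 hn, one_mul], by rw [map_mul, hn']⟩
  have h1 : ∀ g i j, φ g = r i → φ' g ≠ sr j := by
    intro g i j hg hg'
    have hj : sr j ∈ φ.ker.map φ' := by
      refine ⟨g ^ 5, ?_, ?_⟩
      · rw [SetLike.mem_coe, MonoidHom.mem_ker, map_pow, hg, pow_five_r]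
      · rw [map_pow, hg']
        exact sr_pow_five j
    obtain ⟨i, hi⟩ := mem_rotations.1 ((hN _).1 hj)
    exact nomatch hi
  have h2 : ∀ g i j, φ g = sr i → φ' g ≠ r j := by
    intro g i j hg hg'
    obtain ⟨γ, hγ⟩ := h' (sr 0)
    rcases e : φ γ with m | m
    · exact h1 γ m 0 e hγ
    · refine h1 (g * γ) (m - i) (0 - j) ?_ ?_
      · rw [map_mul, hg, e, sr_mul_sr]
      · rw [map_mul, hg', hγ, r_mul_sr]
  ext ⟨u, v⟩
  simp only [mem_pairSet, sameSign, rotations, Finset.mem_union, Finset.mem_product,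
    Finset.mem_image, Finset.mem_univ, true_and]
  constructor
  · rintro ⟨g, rfl, rfl⟩
    rcases e : φ g with i | i <;> rcases e' : φ' g with j | j
    · simp
    · exact absurd e' (h1 g i j e)
    · exact absurd e' (h2 g i j e)
    · simp
  · rintro (⟨⟨i, rfl⟩, ⟨j, rfl⟩⟩ | ⟨⟨i, rfl⟩, ⟨j, rfl⟩⟩)
    · obtain ⟨g, hg⟩ := h (r i)
      rcases e' : φ' g with m | m
      · obtain ⟨g₁, hg₁, hg₁'⟩ := hrot g (j - m)
        exact ⟨g₁, hg₁.trans hg, by rw [hg₁', e', r_mul_r, sub_add_cancel]⟩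
      · exact absurd e' (h1 g i m hg)
    · obtain ⟨g, hg⟩ := h (sr i)
      rcases e' : φ' g with m | m
      · exact absurd e' (h2 g i m hg)
      · obtain ⟨g₁, hg₁, hg₁'⟩ := hrot g (m - j)
        exact ⟨g₁, hg₁.trans hg, by rw [hg₁', e', r_mul_sr, sub_sub_cancel]⟩

theorem index_of_rotations : (φ.ker ⊔ φ'.ker).index = 2 := by
  have h1 := Subgroup.index_map φ.ker φ'
  rw [(Subgroup.eq_top_iff' φ'.range).2 h', Subgroup.index_top, mul_one] at h1
  have h2 := (φ.ker.map φ').card_mul_index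
  rw [card_eq_of_mem_iff hN, card_rotations, DihedralGroup.nat_card, h1] at h2
  omega

end Half

/-- `(C₅ × C₅) ⋊ C₂` as the group of pairs in `D₅ × D₅` of the same sign. -/
theorem iso_of_pairSet_eq_sameSign (hinj : φ.ker ⊓ φ'.ker = ⊥) (hS : pairSet φ φ' = sameSign) :
    Iso Γ C5C5C2 := by
  classical
  let fN : Cyc 5 × Cyc 5 →* DihedralGroup 5 × DihedralGroup 5 :=
    MonoidHom.mk' (fun x => (r x.1.toAdd, r x.2.toAdd)) fun x y => by simp
  let fC : inversionGroup →* DihedralGroup 5 × DihedralGroup 5 :=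
    MonoidHom.mk' (fun g => if g = 1 then 1 else (sr 0, sr 0)) fun g k => by
      have hsq : ∀ g : inversionGroup, g * g = 1 := by
        intro g
        rcases inversion_cases g with rfl | rfl
        · rfl
        · ext1
          exact MulEquiv.ext fun x => inv_inv x
      rcases inversion_cases g with rfl | rfl <;> rcases inversion_cases k with rfl | rfl
      · simp
      · simp
      · simp
      · rw [hsq, if_pos rfl, if_neg inversion_ne_one]
        decide +kernel
  have hC : fC ⟨MulEquiv.inv (Cyc 5 × Cyc 5), Subgroup.mem_zpowers _⟩ = (sr 0, sr 0) := by
    simp only [fC, MonoidHom.mk'_apply, if_neg inversion_ne_one]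
  let F : C5C5C2 →* DihedralGroup 5 × DihedralGroup 5 := SemidirectProduct.lift fN fC (by
    intro g
    ext1 x
    rcases inversion_cases g with rfl | rfl
    · simp
    · simp only [MonoidHom.comp_apply, MulEquiv.coe_toMonoidHom, hC, MulAut.conj_apply]
      change (r (-x.1.toAdd), r (-x.2.toAdd)) =
        (sr 0 * r x.1.toAdd * sr 0, sr 0 * r x.2.toAdd * sr 0)
      simp)
  have hF : ∀ x : C5C5C2, F x = fN x.left * fC x.right := fun x => rfl
  refine iso_of_range_eq (f := φ.prod φ') (f' := F) (prod_injective hinj) ?_ ?_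
  · rw [← MonoidHom.ker_eq_bot_iff, eq_bot_iff]
    rintro ⟨⟨i, j⟩, g⟩ hx
    rw [MonoidHom.mem_ker, hF] at hx
    rcases inversion_cases g with rfl | rfl
    · rw [map_one, mul_one] at hx
      have h1 : r i.toAdd = r 0 := congrArg Prod.fst hx
      have h2 : r j.toAdd = r 0 := congrArg Prod.snd hx
      rw [r.injEq] at h1 h2
      rw [Subgroup.mem_bot]
      ext1
      · exact Prod.ext h1 h2
      · rfl
    · rw [hC] at hx
      have h1 : r i.toAdd * sr 0 = 1 := congrArg Prod.fst hx
      rw [r_mul_sr] at h1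
      exact nomatch h1
  · ext u
    have hu : u ∈ (φ.prod φ').range ↔ u ∈ pairSet φ φ' := by
      rw [mem_pairSet]
      exact exists_congr fun g => Prod.ext_iff
    rw [hu, hS]
    simp only [sameSign, rotations, Finset.mem_union, Finset.mem_product,
      Finset.mem_image, Finset.mem_univ, true_and]
    constructor
    · obtain ⟨u, v⟩ := u
      rintro (⟨⟨i, rfl⟩, ⟨j, rfl⟩⟩ | ⟨⟨i, rfl⟩, ⟨j, rfl⟩⟩)
      · refine ⟨⟨(Multiplicative.ofAdd i, Multiplicative.ofAdd j), 1⟩, ?_⟩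
        rw [hF, map_one, mul_one]
        rfl
      · refine ⟨⟨(Multiplicative.ofAdd (-i), Multiplicative.ofAdd (-j)),
          ⟨MulEquiv.inv (Cyc 5 × Cyc 5), Subgroup.mem_zpowers _⟩⟩, ?_⟩
        rw [hF, hC]
        change (r (-i) * sr 0, r (-j) * sr 0) = _
        simp
    · rintro ⟨⟨⟨i, j⟩, g⟩, rfl⟩
      rw [hF]
      rcases inversion_cases g with rfl | rfl
      · left
        rw [map_one, mul_one]
        exact ⟨⟨_, rfl⟩, ⟨_, rfl⟩⟩
      · right
        rw [hC]
        exact ⟨⟨0 - i.toAdd, rfl⟩, ⟨0 - j.toAdd, rfl⟩⟩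

end Subdirect

/-! ### The table -/

theorem tfae_of_dichotomy {A₁ A₂ B₁ B₂ C₁ C₂ : Prop}
    (h : (A₁ ∧ B₁ ∧ C₁) ∨ (A₂ ∧ B₂ ∧ C₂)) (hA : A₁ → ¬ A₂) (hB : B₁ → ¬ B₂) (hC : C₁ → ¬ C₂) :
    [A₁, B₁, C₁].TFAE ∧ [A₂, B₂, C₂].TFAE := by
  simp only [List.tfae_cons_cons, List.tfae_singleton, and_true]
  tauto

theorem tfae_of_trichotomy {A₁ A₂ A₃ B₁ B₂ B₃ C₁ C₂ C₃ : Prop}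
    (h : (A₁ ∧ B₁ ∧ C₁) ∨ (A₂ ∧ B₂ ∧ C₂) ∨ (A₃ ∧ B₃ ∧ C₃))
    (hA₁₂ : A₁ → ¬ A₂) (hA₁₃ : A₁ → ¬ A₃) (hA₂₃ : A₂ → ¬ A₃)
    (hB₁₂ : B₁ → ¬ B₂) (hB₁₃ : B₁ → ¬ B₃) (hB₂₃ : B₂ → ¬ B₃)
    (hC₁₂ : C₁ → ¬ C₂) (hC₁₃ : C₁ → ¬ C₃) (hC₂₃ : C₂ → ¬ C₃) :
    (A₁ ∨ A₂ ∨ A₃) ∧ [A₁, B₁, C₁].TFAE ∧ [A₂, B₂, C₂].TFAE ∧ [A₃, B₃, C₃].TFAE := by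
  simp only [List.tfae_cons_cons, List.tfae_singleton, and_true]
  rcases h with ⟨a, b, c⟩ | ⟨a, b, c⟩ | ⟨a, b, c⟩
  · simp [a, b, c, hA₁₂ a, hA₁₃ a, hB₁₂ b, hB₁₃ b, hC₁₂ c, hC₁₃ c]
  · have a' : ¬ A₁ := fun x => hA₁₂ x a
    have b' : ¬ B₁ := fun x => hB₁₂ x b
    have c' : ¬ C₁ := fun x => hC₁₂ x c
    simp [a, b, c, a', b', c', hA₂₃ a, hB₂₃ b, hC₂₃ c]
  · have a' : ¬ A₁ := fun x => hA₁₃ x a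
    have b' : ¬ B₁ := fun x => hB₁₃ x b
    have c' : ¬ C₁ := fun x => hC₁₃ x c
    have a'' : ¬ A₂ := fun x => hA₂₃ x a
    have b'' : ¬ B₂ := fun x => hB₂₃ x b
    have c'' : ¬ C₂ := fun x => hC₂₃ x c
    simp [a, b, c, a', b', c', a'', b'', c'']

theorem conj_notMem_reflPair : ∀ b, r 1 * sr b * (r 1)⁻¹ ∉ reflPair b := by
  decide +kernel

section Table

variable {Γ G G' GG : Type*} [Group Γ] [Group G] [Group G'] [Group GG]
  {φ φ' : Γ →* DihedralGroup 5} {M K : Type*} [Field M] [Field K] [Algebra M K]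
  {L L' : IntermediateField M K}

/-- The table, for a group `Γ` with two homomorphisms to `D₅` in place of a Galois group with its
actions on the roots of the two quintics. -/
theorem table_of_hom (hinj : φ.ker ⊓ φ'.ker = ⊥)
    (hle : Nat.card φ'.range ≤ Nat.card φ.range) (hlt : 1 < Nat.card φ'.range)
    (hG : Iso G φ.range) (hG' : Iso G' φ'.range) (hGG : Iso GG Γ)
    (hbot : L ⊓ L' = ⊥ ↔ φ.ker ⊔ φ'.ker = ⊤)
    (hrank : Module.finrank M ↥(L ⊓ L') = (φ.ker ⊔ φ'.ker).index)
    (hLe : L' ≤ L ↔ φ.ker ≤ φ'.ker) (hEq : L = L' ↔ φ.ker = φ'.ker) {μ₁ μ₂ : Multiset ℕ}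
    (hμ₁ : μ₁ = orbitType (pairSet φ φ')) (hμ₂ : μ₂ = orbitType (twistFst (pairSet φ φ'))) :
    Table G G' GG L L' μ₁ μ₂ ∧ (L = L' ↔ 1 ∈ μ₁ ∨ 1 ∈ μ₂) := by
  have : Fact (Nat.Prime 5) := ⟨by norm_num⟩
  have hD : ∀ {φ : Γ →* DihedralGroup 5}, (∀ x, x ∈ φ.range) → Iso φ.range (DihedralGroup 5) :=
    fun h => ⟨(MulEquiv.subgroupCongr ((Subgroup.eq_top_iff' _).2 h)).trans Subgroup.topEquiv⟩
  have hDcard : ∀ {φ : Γ →* DihedralGroup 5}, (∀ x, x ∈ φ.range) → Nat.card φ.range = 10 :=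
    fun h => (hD h).card_eq.trans DihedralGroup.nat_card
  have hRcard : ∀ {φ : Γ →* DihedralGroup 5}, (∀ x, x ∈ φ.range ↔ x ∈ rotations) →
      Nat.card φ.range = 5 := fun h => (card_eq_of_mem_iff h).trans card_rotations
  have hScard : ∀ {φ : Γ →* DihedralGroup 5} {b}, (∀ x, x ∈ φ.range ↔ x ∈ reflPair b) →
      Nat.card φ.range = 2 := fun h => (card_eq_of_mem_iff h).trans (card_reflPair _)
  have hone : ∀ {φ : Γ →* DihedralGroup 5}, (∀ x, x ∈ φ.range ↔ x = 1) →
      Nat.card φ.range = 1 := fun h => card_range_eq_one fun g => (h _).1 ⟨g, rfl⟩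
  have hEqCard : φ.ker = φ'.ker → Nat.card φ.range = Nat.card φ'.range := fun h => by
    rw [← Subgroup.index_ker, ← Subgroup.index_ker, h]
  have hGGfull : φ'.range ≤ φ.ker.map φ' → Iso GG (G × G') := fun h =>
    hGG.trans ((iso_of_full h hinj).trans (hG.prod hG').symm)
  have hGGgraph : φ.ker ≤ φ'.ker → Iso GG G := fun h =>
    hGG.trans ((iso_of_ker_le h hinj).trans hG.symm)
  have hneFull : φ'.range ≤ φ.ker.map φ' → L ≠ L' := fun h e =>
    not_ker_le_of_full h hlt (hEq.1 e).le
  rcases subgroup_cases φ'.range with h' | ⟨c, h'⟩ | h' | h'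
  · exact absurd (hone h') hlt.ne'
  · -- the second group has order 2
    have hc' := hScard h'
    have iG' : Iso G' (Cyc 2) := hG'.trans (iso_cyc hc')
    have hp : (Nat.card φ'.range).Prime := by rw [hc']; norm_num
    rcases subgroup_cases φ.range with h | ⟨b, h⟩ | h | h
    · rw [hone h] at hle
      omega
    · have iG : Iso G (Cyc 2) := hG.trans (iso_cyc (hScard h))
      rcases full_or_ker_le (φ := φ) hp with hf | hk
      · have ht := orbitType_reflPair b c
        rw [← pairSet_of_full hf h h', ← hμ₁, ← hμ₂] at ht
        refine ⟨.inr (.inr (.inr (.inr (.inr ⟨iG, iG', tfae_of_dichotomy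
          (.inl ⟨hneFull hf, (hGGfull hf).trans (iG.prod iG'), ht⟩) id ?_ ?_⟩)))), ?_⟩
        · intro e e'
          have := e.card_eq.symm.trans e'.card_eq
          simp at this
        · rintro ⟨rfl, -⟩ ⟨e, -⟩
          revert e
          decide +kernel
        · simp [hneFull hf, ht.1, ht.2]
      · have ht := orbitType_diag_reflPair b c
        rw [← pairSet_reflPair hk h h', ← hμ₁, ← hμ₂] at ht
        have he : L = L' := hEq.2 (ker_eq_of_card_eq hk hinj ((hScard h).trans hc'.symm))
        refine ⟨.inr (.inr (.inr (.inr (.inr ⟨iG, iG', tfae_of_dichotomy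
          (.inr ⟨he, (hGGgraph hk).trans iG, ht⟩) id ?_ ?_⟩)))), ?_⟩
        · intro e e'
          have := e.card_eq.symm.trans e'.card_eq
          simp at this
        · rintro ⟨rfl, -⟩ ⟨e, -⟩
          revert e
          decide +kernel
        · simp [he, ht.1, ht.2]
    · have iG : Iso G (Cyc 5) := hG.trans (iso_cyc (hRcard h))
      rcases full_or_ker_le (φ := φ) hp with hf | hk
      · have ht := orbitType_rotations_reflPair c
        rw [← pairSet_of_full hf h h', ← hμ₁, ← hμ₂] at ht
        refine ⟨.inr (.inr (.inr (.inr (.inl ⟨iG, iG', hbot.2 (sup_ker_of_full hf),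
          (hGGfull hf).trans ((iG.prod iG').trans iso_cyc_ten), ht⟩)))), ?_⟩
        simp [hneFull hf, ht.1, ht.2]
      · exact (not_rotations_reflPair hk hlt h h').elim
    · have iG : Iso G (DihedralGroup 5) := hG.trans (hD h)
      have hex : ∀ {H : Type _} [Group H], Iso H (DihedralGroup 10) →
          ¬ Iso H (DihedralGroup 5) := by
        intro H _ e e'
        have := e.card_eq.symm.trans e'.card_eq
        rw [DihedralGroup.nat_card, DihedralGroup.nat_card] at this
        omega
      have hne : L ≠ L' := fun e => by
        have := hEqCard (hEq.1 e)
        rw [hDcard h, hc'] at this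
        omega
      rcases full_or_ker_le (φ := φ) hp with hf | hk
      · have ht := (orbitType_univ_reflPair c)
        rw [← pairSet_of_full hf (by simpa using h) h', ← hμ₁, ← hμ₂] at ht
        refine ⟨.inr (.inr (.inl ⟨iG, iG', tfae_of_dichotomy (.inl ⟨fun e =>
          not_ker_le_of_full hf hlt (hLe.1 e), (hGGfull hf).trans
          ((iG.prod iG').trans iso_dihedral_ten), ht⟩) id hex ?_⟩)), ?_⟩
        · rintro ⟨rfl, -⟩ ⟨e, -⟩
          revert e
          decide +kernel
        · simp [hne, ht.1, ht.2]
      · have ht := orbitType_graphSign c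
        rw [← pairSet_univ_reflPair hk h h', ← hμ₁, ← hμ₂] at ht
        refine ⟨.inr (.inr (.inl ⟨iG, iG', tfae_of_dichotomy (.inr ⟨hLe.2 hk,
          (hGGgraph hk).trans iG, ht⟩) id hex ?_⟩)), ?_⟩
        · rintro ⟨rfl, -⟩ ⟨e, -⟩
          revert e
          decide +kernel
        · simp [hne, ht.1, ht.2]
  · -- the second group has order 5
    have hc' := hRcard h'
    have iG' : Iso G' (Cyc 5) := hG'.trans (iso_cyc hc')
    have hp : (Nat.card φ'.range).Prime := by rw [hc']; norm_num
    rcases subgroup_cases φ.range with h | ⟨b, h⟩ | h | h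
    · rw [hone h] at hle
      omega
    · rw [hScard h] at hle
      omega
    · have iG : Iso G (Cyc 5) := hG.trans (iso_cyc (hRcard h))
      have hex : ∀ {H : Type _} [Group H], Iso H (Cyc 5 × Cyc 5) → ¬ Iso H (Cyc 5) := by
        intro H _ e e'
        have := e.card_eq.symm.trans e'.card_eq
        simp at this
      have hexC : μ₁ = {5, 5} ∧ μ₂ = {5, 5} → ¬ ((μ₁ = {5, 1, 1, 1, 1, 1} ∧ μ₂ = {5, 5}) ∨
          (μ₁ = {5, 5} ∧ μ₂ = {5, 1, 1, 1, 1, 1})) := by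
        rintro ⟨rfl, rfl⟩
        decide +kernel
      rcases full_or_ker_le (φ := φ) hp with hf | hk
      · have ht := orbitType_rotations
        rw [← pairSet_of_full hf h h', ← hμ₁, ← hμ₂] at ht
        refine ⟨.inr (.inr (.inr (.inl ⟨iG, iG', tfae_of_dichotomy (.inl ⟨hneFull hf,
          (hGGfull hf).trans (iG.prod iG'), ht⟩) id hex hexC⟩))), ?_⟩
        simp [hneFull hf, ht.1, ht.2]
      · obtain ⟨k, hk0, hS⟩ := pairSet_rotations hk hlt h h'
        have ht := orbitType_graph_rotations k hk0
        rw [← hS, ← hμ₁, ← hμ₂] at ht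
        have he : L = L' := hEq.2 (ker_eq_of_card_eq hk hinj ((hRcard h).trans hc'.symm))
        refine ⟨.inr (.inr (.inr (.inl ⟨iG, iG', tfae_of_dichotomy (.inr ⟨he,
          (hGGgraph hk).trans iG, ht⟩) id hex hexC⟩))), ?_⟩
        rcases ht with ht | ht <;> simp [he, ht.1, ht.2]
    · have iG : Iso G (DihedralGroup 5) := hG.trans (hD h)
      rcases full_or_ker_le (φ := φ) hp with hf | hk
      · have ht := orbitType_univ_rotations
        rw [← pairSet_of_full hf (by simpa using h) h', ← hμ₁, ← hμ₂] at ht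
        refine ⟨.inr (.inl ⟨iG, iG', hbot.2 (sup_ker_of_full hf),
          (hGGfull hf).trans (iG.prod iG'), ht⟩), ?_⟩
        simp [hneFull hf, ht.1, ht.2]
      · exact (not_univ_rotations hk hlt h h').elim
  · -- the second group has order 10, hence so has the first
    have hc' := hDcard h'
    have iG' : Iso G' (DihedralGroup 5) := hG'.trans (hD h')
    rw [hc'] at hle
    rcases subgroup_cases φ.range with h | ⟨b, h⟩ | h | h
    · rw [hone h] at hle
      omega
    · rw [hScard h] at hle
      omega
    · rw [hRcard h] at hle
      omega
    have iG : Iso G (DihedralGroup 5) := hG.trans (hD h)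
    have cardC : Nat.card C5C5C2 = 50 := by
      have h2 : Nat.card inversionGroup = 2 := by
        rw [Nat.card_zpowers]
        refine orderOf_eq_prime (p := 2) ?_ fun e => inversion_ne_one (Subtype.ext e)
        rw [sq]
        exact MulEquiv.ext fun x => inv_inv x
      rw [SemidirectProduct.card, h2]
      simp
    have cardDD : Nat.card (DihedralGroup 5 × DihedralGroup 5) = 100 := by
      rw [Nat.card_prod, DihedralGroup.nat_card]
    have cardD : Nat.card (DihedralGroup 5) = 10 := DihedralGroup.nat_card
    have hrankEq : L = L' → Module.finrank M ↥(L ⊓ L') = 10 := fun e => by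
      rw [hrank, ← hEq.1 e, sup_idem, Subgroup.index_ker, hDcard h]
    have hrankBot : L ⊓ L' = ⊥ → Module.finrank M ↥(L ⊓ L') = 1 := fun e => by
      rw [hrank, hbot.1 e, Subgroup.index_top]
    have main : ((L ⊓ L' = ⊥ ∧ Iso GG (DihedralGroup 5 × DihedralGroup 5) ∧
          μ₁ = {10} ∧ μ₂ = {10}) ∨
        (Module.finrank M ↥(L ⊓ L') = 2 ∧ Iso GG C5C5C2 ∧ μ₁ = {5, 5} ∧ μ₂ = {5, 5}) ∨
        (L = L' ∧ Iso GG (DihedralGroup 5) ∧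
          ((μ₁ = {5, 2, 2, 1} ∧ μ₂ = {5, 5}) ∨ (μ₁ = {5, 5} ∧ μ₂ = {5, 2, 2, 1})))) := by
      have hgraph : φ.ker ≤ φ'.ker → (L = L' ∧ Iso GG (DihedralGroup 5) ∧
          ((μ₁ = {5, 2, 2, 1} ∧ μ₂ = {5, 5}) ∨ (μ₁ = {5, 5} ∧ μ₂ = {5, 2, 2, 1}))) := by
        intro hk
        obtain ⟨k, b, hk0, hS⟩ := pairSet_univ hk hinj h h'
        have ht := orbitType_graphAut k b hk0
        rw [← hS, ← hμ₁, ← hμ₂] at ht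
        exact ⟨hEq.2 (ker_eq_of_card_eq hk hinj ((hDcard h).trans hc'.symm)),
          (hGGgraph hk).trans iG, ht⟩
      rcases subgroup_cases (φ.ker.map φ') with hN | ⟨b, hN⟩ | hN | hN
      · exact .inr (.inr (hgraph fun g hg => (hN _).1 ⟨g, hg, rfl⟩))
      · -- a subgroup generated by a reflection is not normal
        exfalso
        obtain ⟨n, hn, hn'⟩ := (hN (sr b)).2 (mem_reflPair.2 (.inr rfl))
        obtain ⟨g, hg⟩ := h' (r 1)
        have hmem : r 1 * sr b * (r 1)⁻¹ ∈ reflPair b := by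
          rw [← hN]
          refine ⟨g * n * g⁻¹, (MonoidHom.normal_ker φ).conj_mem n hn g, ?_⟩
          rw [map_mul, map_mul, map_inv, hg, hn']
        exact conj_notMem_reflPair b hmem
      · have hS := pairSet_of_rotations h' hN h
        have ht := orbitType_sameSign
        rw [← hS, ← hμ₁, ← hμ₂] at ht
        exact .inr (.inl ⟨hrank.trans (index_of_rotations h' hN),
          hGG.trans (iso_of_pairSet_eq_sameSign hinj hS), ht⟩)
      · have hf : φ'.range ≤ φ.ker.map φ' := fun x _ => hN x
        have ht := orbitType_univ
        rw [← pairSet_of_full hf (by simpa using h) (by simpa using h'), ← hμ₁, ← hμ₂] at ht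
        exact .inl ⟨hbot.2 (sup_ker_of_full hf), (hGGfull hf).trans (iG.prod iG'), ht⟩
    constructor
    · refine .inl ⟨iG, iG', tfae_of_trichotomy main ?_ ?_ ?_ ?_ ?_ ?_ ?_ ?_ ?_⟩
      · intro e e'
        rw [hrankBot e] at e'
        omega
      · intro e e'
        have := (hrankBot e).symm.trans (hrankEq e')
        omega
      · intro e e'
        rw [hrankEq e'] at e
        omega
      · intro e e'
        have := e.card_eq.symm.trans e'.card_eq
        omega
      · intro e e'
        have := e.card_eq.symm.trans e'.card_eq
        omega
      · intro e e'
        have := e.card_eq.symm.trans e'.card_eq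
        omega
      · rintro ⟨rfl, rfl⟩
        decide +kernel
      · rintro ⟨rfl, rfl⟩
        decide +kernel
      · rintro ⟨rfl, rfl⟩
        decide +kernel
    · rcases main with ⟨e, -, ht⟩ | ⟨e, -, ht⟩ | ⟨e, -, ht⟩
      · have hne : L ≠ L' := fun e' => by
          have := (hrankBot e).symm.trans (hrankEq e')
          omega
        simp [hne, ht.1, ht.2]
      · have hne : L ≠ L' := fun e' => by
          rw [hrankEq e'] at e
          omega
        simp [hne, ht.1, ht.2]
      · rcases ht with ht | ht <;> simp [e, ht.1, ht.2]

end Table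

/-! ### The Galois correspondence -/

section Correspondence

variable {M : Type*} [Field M] {K : Type*} [Field K] [Algebra M K] {a a' : M × M}
  (E : IntermediateField M K)

theorem map_val_le_iff {A B : IntermediateField M E} :
    A.map E.val ≤ B.map E.val ↔ A ≤ B := by
  rw [IntermediateField.map_le_iff_le_comap]
  refine ⟨fun h x hx => ?_, fun h x hx => ⟨x, h hx, rfl⟩⟩
  obtain ⟨y, hy, hxy⟩ := h hx
  rwa [← Subtype.ext hxy]

theorem le_iff_fixingSubgroup_le [FiniteDimensional M E] [IsGalois M E]
    {A B : IntermediateField M E} :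
    A ≤ B ↔ B.fixingSubgroup ≤ A.fixingSubgroup :=
  (OrderIso.le_iff_le IsGalois.intermediateFieldEquivSubgroup).symm

theorem fixingSubgroup_inf [FiniteDimensional M E] [IsGalois M E]
    (A B : IntermediateField M E) :
    (A ⊓ B).fixingSubgroup = A.fixingSubgroup ⊔ B.fixingSubgroup :=
  congrArg OrderDual.ofDual
    (map_inf (IsGalois.intermediateFieldEquivSubgroup (F := M) (E := E)) A B)

theorem splittingField_sup_eq_top
    (hE : IntermediateField.adjoin M ((quintic a * quintic a').rootSet E) = ⊤) :
    splittingField E a ⊔ splittingField E a' = ⊤ := by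
  rw [eq_top_iff, ← hE, IntermediateField.adjoin_le_iff]
  intro u hu
  have h0 := (mem_rootSet.1 hu).2
  rw [map_mul, mul_eq_zero] at h0
  rcases h0 with h0 | h0
  · exact (le_sup_left : splittingField E a ≤ _) (IntermediateField.subset_adjoin M _
      ((mem_rootSet_of_ne (quintic_ne_zero a)).2 h0))
  · exact (le_sup_right : splittingField E a' ≤ _) (IntermediateField.subset_adjoin M _
      ((mem_rootSet_of_ne (quintic_ne_zero a')).2 h0))

/-- The decomposition types and the table, computed in a splitting field `E` of the product of the
two quintics from orderings of their roots. -/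
theorem exists_types_of_liesOver [Infinite M] [FiniteDimensional M E] [IsGalois M E]
    [IsSplittingField M E (quintic a * quintic a')]
    (ha : (quintic a).Separable) (ha' : (quintic a').Separable)
    (hle : Nat.card (quintic a').Gal ≤ Nat.card (quintic a).Gal)
    (hlt : 1 < Nat.card (quintic a').Gal) {x y x' y' : K} (hxy : LiesOver a x y)
    (hxy' : LiesOver a' x' y') (hsub : (quintic a).rootSet K ⊆ E)
    (hsub' : (quintic a').rootSet K ⊆ E) :
    ∃ μ₁ μ₂ : Multiset ℕ,
      (∀ μ, IsDT₁ K a a' μ ↔ μ = μ₁) ∧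
      (∀ μ, IsDT₂ K a a' μ ↔ μ = μ₂) ∧
      Table (quintic a).Gal (quintic a').Gal (quintic a * quintic a').Gal
        (splittingField K a) (splittingField K a') μ₁ μ₂ ∧
      (splittingField K a = splittingField K a' ↔ 1 ∈ μ₁ ∨ 1 ∈ μ₂) := by
  obtain ⟨u, v, huv, hf⟩ := hxy.exists_lift hsub
  obtain ⟨u', v', huv', hf'⟩ := hxy'.exists_lift hsub'
  obtain ⟨φ, hφ⟩ := huv.exists_hom ha
  obtain ⟨φ', hφ'⟩ := huv'.exists_hom ha'
  have hL := map_splittingField hxy huv hf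
  have hL' := map_splittingField hxy' huv' hf'
  have hk := huv.fixingSubgroup_splittingField ha hφ
  have hk' := huv'.fixingSubgroup_splittingField ha' hφ'
  obtain ⟨eG⟩ := huv.nonempty_gal_equiv ha hφ
  obtain ⟨eG'⟩ := huv'.nonempty_gal_equiv ha' hφ'
  have hGG : Iso (quintic a * quintic a').Gal (E ≃ₐ[M] E) :=
    ⟨(IsSplittingField.algEquiv E (quintic a * quintic a')).symm.autCongr⟩
  have hinf : (splittingField E a ⊓ splittingField E a').fixingSubgroup = φ.ker ⊔ φ'.ker := by
    rw [fixingSubgroup_inf, hk, hk']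
  have hmapinf : splittingField K a ⊓ splittingField K a' =
      (splittingField E a ⊓ splittingField E a').map E.val := by
    rw [IntermediateField.map_inf, hL, hL']
  have hinj : φ.ker ⊓ φ'.ker = ⊥ := by
    rw [← hk, ← hk', ← IntermediateField.fixingSubgroup_sup, splittingField_sup_eq_top E
      (isSplittingField_iff_intermediateField.1 ‹_›).2, IntermediateField.fixingSubgroup_top]
  have hbot : splittingField K a ⊓ splittingField K a' = ⊥ ↔ φ.ker ⊔ φ'.ker = ⊤ := by
    rw [hmapinf, ← hinf, ← le_bot_iff, ← IntermediateField.map_bot E.val, map_val_le_iff,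
      le_iff_fixingSubgroup_le, IntermediateField.fixingSubgroup_bot, top_le_iff]
  have hrank : Module.finrank M ↥(splittingField K a ⊓ splittingField K a') =
      (φ.ker ⊔ φ'.ker).index := by
    rw [hmapinf, ← hinf, ← IntermediateField.finrank_eq_fixingSubgroup_index]
    exact (IntermediateField.equivMap _ E.val).toLinearEquiv.finrank_eq.symm
  have hLe : splittingField K a' ≤ splittingField K a ↔ φ.ker ≤ φ'.ker := by
    rw [← hL, ← hL', map_val_le_iff, le_iff_fixingSubgroup_le, hk, hk']
  have hLe' : splittingField K a ≤ splittingField K a' ↔ φ'.ker ≤ φ.ker := by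
    rw [← hL, ← hL', map_val_le_iff, le_iff_fixingSubgroup_le, hk, hk']
  have hEq : splittingField K a = splittingField K a' ↔ φ.ker = φ'.ker := by
    rw [le_antisymm_iff, le_antisymm_iff, hLe, hLe', and_comm]
  have hz := huv.injective ha
  have hz' := huv'.injective ha'
  refine ⟨orbitType (pairSet φ φ'), orbitType (twistFst (pairSet φ φ')), ?_, ?_, ?_⟩
  · intro μ
    rw [isDT₁_iff hxy hxy' ha ha', funext hf, funext hf']
    exact isResolventType_iff φ φ' hz hz' hφ hφ' μ
  · intro μ
    have hmoeb : (fun i => moebius (formalRoots x y (2 * i))) =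
        fun i => algebraMap E K (moebius (formalRoots u v (2 * i))) := by
      funext i
      rw [hf]
      simp only [moebius, map_div₀, map_sub, map_one]
    rw [isDT₂_iff hxy hxy' ha ha', ← twistFst_pairSet, funext hf', hmoeb]
    refine isResolventType_iff (z := fun i => moebius (formalRoots u v (2 * i))) _ φ' ?_ hz' ?_
      hφ' μ
    · intro i j hij
      have h2 : ∀ i j : Fin 5, 2 * i = 2 * j → i = j := by decide
      exact h2 i j (hz (eq_of_moebius_eq (huv.isCycle.ne_one hz _) (huv.isCycle.ne_one hz _) hij))
    · intro g i
      have : g (moebius (formalRoots u v (2 * i))) = moebius (g (formalRoots u v (2 * i))) := by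
        simp only [moebius, map_div₀, map_sub, map_one]
      rw [this, hφ, ← two_mul_act_twist]
      rfl
  · refine table_of_hom hinj ?_ ?_ ⟨eG⟩ ⟨eG'⟩ hGG hbot hrank hLe hEq rfl rfl
    · rwa [Nat.card_congr eG.toEquiv, Nat.card_congr eG'.toEquiv] at hle
    · rwa [Nat.card_congr eG'.toEquiv] at hlt

end Correspondence

end Brumer

end

theorem theorem5p2 {M : Type*} [Field M] [Infinite M]
    {K : Type*} [Field K] [Algebra M K] [IsAlgClosure M K]
    (a a' : M × M)
    (ha : (Brumer.quintic a).Separable) (ha' : (Brumer.quintic a').Separable)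
    (hle : Nat.card (Brumer.quintic a').Gal ≤ Nat.card (Brumer.quintic a).Gal)
    (hlt : 1 < Nat.card (Brumer.quintic a').Gal) :
    ∃ μ₁ μ₂ : Multiset ℕ,
      -- the decomposition types of the two resolvents exist and are well defined
      (∀ μ, Brumer.IsDT₁ K a a' μ ↔ μ = μ₁) ∧
      (∀ μ, Brumer.IsDT₂ K a a' μ ↔ μ = μ₂) ∧
      Brumer.Table (Brumer.quintic a).Gal (Brumer.quintic a').Gal
        (Brumer.quintic a * Brumer.quintic a').Gal
        (Brumer.splittingField K a) (Brumer.splittingField K a') μ₁ μ₂ ∧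
      (Brumer.splittingField K a = Brumer.splittingField K a' ↔ 1 ∈ μ₁ ∨ 1 ∈ μ₂) := by
  have : IsAlgClosed K := IsAlgClosure.isAlgClosed M
  obtain ⟨x, y, hxy⟩ := Brumer.exists_liesOver (K := K) ha
  obtain ⟨x', y', hxy'⟩ := Brumer.exists_liesOver (K := K) ha'
  have hne := mul_ne_zero (Brumer.quintic_ne_zero a) (Brumer.quintic_ne_zero a')
  have : Polynomial.IsSplittingField M (Brumer.compositum K a a')
      (Brumer.quintic a * Brumer.quintic a') :=
    IntermediateField.adjoin_rootSet_isSplittingField (IsAlgClosed.splits _)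
  have : FiniteDimensional M (Brumer.compositum K a a') :=
    Polynomial.IsSplittingField.finiteDimensional _ (Brumer.quintic a * Brumer.quintic a')
  have : IsGalois M (Brumer.compositum K a a') := Brumer.isGalois_compositum ha ha'
  refine Brumer.exists_types_of_liesOver (Brumer.compositum K a a') ha ha' hle hlt hxy hxy' ?_ ?_
  all_goals
    refine fun u hu => IntermediateField.subset_adjoin M _ ((Polynomial.mem_rootSet_of_ne hne).2 ?_)
    rw [map_mul, (Polynomial.mem_rootSet.1 hu).2]
    simp
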